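/- Let $\mathfrak{H}=\mathbb{Q}\langle x,y\rangle$ be the non-commutative polynomial ring and $\mathfrak{H}^1=\mathbb{Q}+y\mathfrak{H}$. A 2-poset is a finite partially ordered set $X$ with a label map $\delta_X:X\to\{x,y\}$. Let $\mathfrak{P}$ be the $\mathbb{Q}$-algebra of formal linear combinations of isomorphism classes of 2-posets, with multiplication given by disjoint union $\sqcup$ (elements of different components being incomparable). Let $W:\mathfrak{P}\to\mathfrak{H}$ be the $\mathbb{Q}$-linear map with $W(X)=\sum_f \delta_X(f^{-1}(1))\cdots\delta_X(f^{-1}(n))$, where $n=\#X$ and $f$ runs over all order preserving bijections $X\to\{1,\dots,n\}$; extend $W$ coefficientwise to $\mathfrak{P}[[t]]\to\mathfrak{H}[[t]]$. An index is a (possibly empty) tuple $\boldsymbol{k}=(k_1,\dots,k_r)$ of positive integers; its weight is $k_1+\cdots+k_r$. Let $X^\star(\boldsymbol{k})$ be the 2-poset with elements $p_{i,a}$ ($1\le i\le r$, $0\le a\le k_i-1$), with the partial order generated by $p_{i,0}<p_{i,1}<\cdots<p_{i,k_i-1}$ ($1\le i\le r$) and $p_{i,0}<p_{i+1,k_{i+1}-1}$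 ($1\le i<r$), where each $p_{i,0}$ is labelled $y$ and all other elements are labelled $x$. Put $w^\star(\boldsymbol{k})=W(X^\star(\boldsymbol{k}))$ and $w^\star_{\widehat{\mathcal S}}(\boldsymbol{k})=W(X^\star_{\widehat{\mathcal S}}(\boldsymbol{k}))$, where $$X^\star_{\widehat{\mathcal S}}(\boldsymbol{k})=\sum_{i=0}^r(-1)^{k_{i+1}+\cdots+k_r}X^\star(k_1,\dots,k_i)\sqcup\sum_{l_{i+1},\dots,l_r\ge0}\ \prod_{j=i+1}^r\binom{k_j+l_j-1}{l_j}X^\star(k_r+l_r,\dots,k_{i+1}+l_{i+1})\,t^{l_{i+1}+\cdots+l_r}\in\mathfrak{P}[[t]].$$ For an index $\boldsymbol{k}=(k_1,\dots,k_r)$ of weight $k$ put $$w^\star_{\mathrm{CSF}}(\boldsymbol{k})=\sum_{i=1}^r\sum_{j=0}^{k_i-2}w^\star(j+1,k_{i+1},\dots,k_r,k_1,\dots,k_{i-1},k_i-j)-k\,w^\star(k+1),$$ $$w^\star_{\mathrm{CSF},\widehat{\mathcal S}}(\boldsymbol{k})=\sum_{i=1}^r\sum_{j=0}^{k_i-2}w^\star_{\widehat{\mathcal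 S}}(j+1,k_{i+1},\dots,k_r,k_1,\dots,k_{i-1},k_i-j)-\sum_{i=1}^r\sum_{j=0}^\infty w^\star_{\widehat{\mathcal S}}(j+1,k_{i+1},\dots,k_r,k_1,\dots,k_i)\,t^j-k\,w^\star_{\widehat{\mathcal S}}(k+1).$$ Theorem. Let $\boldsymbol{k}=(k_1,\dots,k_r)$ be an index of weight $k$. Then $w^\star_{\mathrm{CSF}}(\boldsymbol{k})\in\mathfrak{H}^1$, $w^\star_{\mathrm{CSF},\widehat{\mathcal S}}(\boldsymbol{k})\in\mathfrak{H}^1[[t]]$, and the following equality holds in $\mathfrak{H}^1[[t]]$: $$w^\star_{\mathrm{CSF},\widehat{\mathcal S}}(\boldsymbol{k})=w^\star_{\mathrm{CSF}}(\boldsymbol{k})+(-1)^{k+1}\sum_{(l_1,\dots,l_r)\in\mathbb{Z}_{\ge0}^r}\ \prod_{j=1}^r\binom{k_j+l_j-1}{l_j}\,w^\star_{\mathrm{CSF}}(k_r+l_r,\dots,k_1+l_1)\,t^{l_1+\cdots+l_r}.$$ -/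

import Mathlib

noncomputable section

namespace KYStar

/-! ### The non-commutative polynomial ring and its subalgebra -/

/-- The two letters `x`, `y`. -/
inductive Letter : Type
  | x : Letter
  | y : Letter

/-- `ℌ = ℚ⟨x, y⟩`, the non-commutative polynomial ring over `ℚ` in two variables. -/
abbrev H : Type := FreeAlgebra ℚ Letter

/-- A letter viewed as a variable of `ℌ`. -/
def var (u : Letter) : H := FreeAlgebra.ι ℚ u

/-- `ℌ¹ = ℚ + yℌ`, a `ℚ`-subalgebra of `ℌ`. -/
def H1 : Subalgebra ℚ H where
  carrier := {w | ∃ (c : ℚ) (h : H), w = algebraMap ℚ H c + var Letter.y * h}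
  mul_mem' := by
    rintro _ _ ⟨c, h, rfl⟩ ⟨d, g, rfl⟩
    refine ⟨c * d, h * algebraMap ℚ H d + algebraMap ℚ H c * g + h * (var Letter.y * g), ?_⟩
    have e := Algebra.commutes c (var Letter.y)
    rw [map_mul, add_mul, mul_add, mul_add, ← mul_assoc (algebraMap ℚ H c) (var Letter.y) g, e]
    noncomm_ring
  add_mem' := by
    rintro _ _ ⟨c, h, rfl⟩ ⟨d, g, rfl⟩
    refine ⟨c + d, h + g, ?_⟩
    rw [map_add, mul_add]
    abel
  algebraMap_mem' := fun c => ⟨c, 0, by simp⟩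

/-! ### 2-posets -/

/-- A 2-poset: a finite partially ordered set together with a labelling of its elements by the
letters `x`, `y`. -/
structure TwoPoset : Type 1 where
  carrier : Type
  [fintype : Fintype carrier]
  [order : PartialOrder carrier]
  label : carrier → Letter

attribute [instance] TwoPoset.fintype TwoPoset.order

namespace TwoPoset

/-- Two 2-posets are isomorphic if there is an order isomorphism preserving the labels. -/
def Isom (X Y : TwoPoset) : Prop :=
  ∃ e : X.carrier ≃o Y.carrier, ∀ p, Y.label (e p) = X.label p

theorem Isom.refl (X : TwoPoset) : Isom X X := ⟨OrderIso.refl _, fun _ => rfl⟩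

theorem Isom.symm {X Y : TwoPoset} : Isom X Y → Isom Y X := by
  rintro ⟨e, he⟩
  exact ⟨e.symm, fun p => by rw [← he (e.symm p), e.apply_symm_apply]⟩

theorem Isom.trans {X Y Z : TwoPoset} : Isom X Y → Isom Y Z → Isom X Z := by
  rintro ⟨e, he⟩ ⟨f, hf⟩
  exact ⟨e.trans f, fun p => by rw [OrderIso.trans_apply, hf, he]⟩

instance setoid : Setoid TwoPoset := ⟨Isom, Isom.refl, Isom.symm, Isom.trans⟩

/-- The empty 2-poset. -/
def empty : TwoPoset where
  carrier := Fin 0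
  label := fun p => p.elim0

/-- The disjoint union of two 2-posets: elements of different components are incomparable. -/
def disj (X Y : TwoPoset) : TwoPoset where
  carrier := X.carrier ⊕ Y.carrier
  label := Sum.elim X.label Y.label

/-- `W(X) = ∑_f u₁ ⋯ u_n`, the sum being over all order preserving bijections
`f : X → {1, …, n}`, `n = #X`, where `u_i` is the label of `f⁻¹(i)`. -/
def W (X : TwoPoset) : H :=
  open Classical in
  ∑ f : X.carrier ≃ Fin (Fintype.card X.carrier) with ∀ p q, p ≤ q → f p ≤ f q,
    (List.ofFn fun i => var (X.label (f.symm i))).prod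

theorem W_congr {X Y : TwoPoset} (h : Isom X Y) : W X = W Y := by
  classical
  obtain ⟨e, he⟩ := h
  have hc : Fintype.card X.carrier = Fintype.card Y.carrier := Fintype.card_congr e.toEquiv
  have key : ∀ (n m : ℕ) (hnm : n = m),
      (∑ f : X.carrier ≃ Fin n with ∀ p q, p ≤ q → f p ≤ f q,
        (List.ofFn fun i => var (X.label (f.symm i))).prod) =
      ∑ f : Y.carrier ≃ Fin m with ∀ p q, p ≤ q → f p ≤ f q,
        (List.ofFn fun i => var (Y.label (f.symm i))).prod := by
    rintro n _ rfl
    refine Finset.sum_equiv (e.toEquiv.equivCongr (Equiv.refl _)) ?_ ?_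
    · intro f
      simp only [Finset.mem_filter, Finset.mem_univ, true_and]
      constructor
      · intro hf a b hab
        exact hf _ _ (e.symm.monotone hab)
      · intro hf a b hab
        have := hf _ _ (e.monotone hab)
        simpa using this
    · intro f _
      congr 2
      funext i
      rw [← he]
      rfl
  unfold W
  convert key _ _ hc

end TwoPoset

/-- Isomorphism classes of 2-posets. -/
def TwoPosetClass : Type 1 := Quotient TwoPoset.setoid

namespace TwoPosetClass

/-- The isomorphism class of a 2-poset. -/
def mk (X : TwoPoset) : TwoPosetClass := Quotient.mk TwoPoset.setoid X

/-- Isomorphism classes of 2-posets form a commutative monoid under disjoint union. -/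
instance : CommMonoid TwoPosetClass where
  mul := Quotient.map₂ TwoPoset.disj (by
    rintro X X' ⟨e, he⟩ Y Y' ⟨f, hf⟩
    refine ⟨OrderIso.sumCongr e f, ?_⟩
    rintro (p | p)
    · exact he p
    · exact hf p)
  mul_assoc := by
    rintro ⟨X⟩ ⟨Y⟩ ⟨Z⟩
    refine Quotient.sound ⟨OrderIso.sumAssoc X.carrier Y.carrier Z.carrier, ?_⟩
    rintro ((p | p) | p) <;> rfl
  one := Quotient.mk _ TwoPoset.empty
  one_mul := by
    rintro ⟨X⟩
    refine Quotient.sound (TwoPoset.Isom.symm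
      ⟨⟨(Equiv.emptySum (Fin 0) X.carrier).symm, ?_⟩, fun p => rfl⟩)
    intro a b
    exact Sum.inr_le_inr_iff
  mul_one := by
    rintro ⟨X⟩
    refine Quotient.sound (TwoPoset.Isom.symm
      ⟨⟨(Equiv.sumEmpty X.carrier (Fin 0)).symm, ?_⟩, fun p => rfl⟩)
    intro a b
    exact Sum.inl_le_inl_iff
  mul_comm := by
    rintro ⟨X⟩ ⟨Y⟩
    refine Quotient.sound ⟨OrderIso.sumComm X.carrier Y.carrier, ?_⟩
    rintro (p | p) <;> rfl

/-- The value of `W` on an isomorphism class. -/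
def W : TwoPosetClass → H := Quotient.lift TwoPoset.W fun _ _ h => TwoPoset.W_congr h

end TwoPosetClass

/-- `𝔓`: the `ℚ`-algebra of formal linear combinations of isomorphism classes of 2-posets, with
multiplication given by disjoint union. -/
abbrev P : Type 1 := MonoidAlgebra ℚ TwoPosetClass

/-- The class of a 2-poset in `𝔓`. -/
def cls (X : TwoPoset) : P := MonoidAlgebra.single (TwoPosetClass.mk X) 1

theorem cls_mul (X Y : TwoPoset) : cls X * cls Y = cls (X.disj Y) := by
  unfold cls
  rw [MonoidAlgebra.single_mul_single, mul_one]
  rfl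

/-- The `ℚ`-linear map `W : 𝔓 → ℌ`. -/
def W : P →ₗ[ℚ] H :=
  Finsupp.linearCombination ℚ TwoPosetClass.W ∘ₗ
    (MonoidAlgebra.coeffLinearEquiv (R := ℚ) (S := ℚ) (M := TwoPosetClass)).toLinearMap

theorem W_cls (X : TwoPoset) : W (cls X) = X.W := by
  simp only [W, cls, LinearMap.comp_apply, LinearEquiv.coe_coe,
    MonoidAlgebra.coeffLinearEquiv_apply, MonoidAlgebra.coeff_single,
    Finsupp.linearCombination_single, one_smul]
  rfl

/-- The coefficientwise extension `W : 𝔓[[t]] → ℌ[[t]]`. -/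
def Wt (F : PowerSeries P) : PowerSeries H :=
  PowerSeries.mk fun n => W (PowerSeries.coeff n F)

/-! ### The zigzag 2-poset `X⋆(k)`

Indices are lists of (positive) natural numbers; the entry `k_{i+1}` is `k.get i`. -/

/-- Elements of `X⋆(k)`: a segment number `i` and a position `0 ≤ a < k_i` (from bottom to top)
in the `i`-th segment. -/
structure Zig (k : List ℕ) : Type where
  seg : Fin k.length
  pos : Fin (k.get seg)

/-- The edges of the Hasse diagram of `X⋆(k)`, from the lower to the upper vertex: each segment is
a chain, and the bottom of the segment of `k_i` lies below the top of the segment of `k_{i+1}`. -/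
inductive Zig.Edge {k : List ℕ} : Zig k → Zig k → Prop
  | chain (i : Fin k.length) (a b : Fin (k.get i)) (h : (b : ℕ) = a + 1) : Zig.Edge ⟨i, a⟩ ⟨i, b⟩
  | link (i j : Fin k.length) (a : Fin (k.get i)) (b : Fin (k.get j)) (hij : (j : ℕ) = i + 1)
      (ha : (a : ℕ) = 0) (hb : (b : ℕ) + 1 = k.get j) : Zig.Edge ⟨i, a⟩ ⟨j, b⟩

theorem Zig.reach_rank {k : List ℕ} {p q : Zig k} (h : Relation.ReflTransGen Zig.Edge p q) :
    p = q ∨ (p.seg : ℕ) < q.seg ∨ ((p.seg : ℕ) = q.seg ∧ (p.pos : ℕ) < q.pos) := by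
  induction h with
  | refl => exact Or.inl rfl
  | tail _ e ih =>
    refine Or.inr ?_
    cases e with
    | chain i a b h =>
      rcases ih with rfl | ih | ih
      · exact Or.inr ⟨rfl, by simp only; omega⟩
      · exact Or.inl ih
      · exact Or.inr ⟨ih.1, by have := ih.2; simp only at this ⊢; omega⟩
    | link i j a b hij ha hb =>
      refine Or.inl ?_
      rcases ih with rfl | ih | ih
      · simp only; omega
      · simp only at ih ⊢; omega
      · have := ih.1; simp only at this ⊢; omega

/-- The partial order generated by the edges. -/
instance Zig.order (k : List ℕ) : PartialOrder (Zig k) where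
  le := Relation.ReflTransGen Zig.Edge
  le_refl := fun _ => Relation.ReflTransGen.refl
  le_trans := fun _ _ _ => Relation.ReflTransGen.trans
  le_antisymm := by
    intro p q h1 h2
    rcases Zig.reach_rank h1 with h | h | h
    · exact h
    all_goals
      rcases Zig.reach_rank h2 with h' | h' | h'
      · exact h'.symm
      all_goals omega

/-- `Zig k` as a disjoint union of chains (as a type). -/
def Zig.equiv (k : List ℕ) : Zig k ≃ (Σ i : Fin k.length, Fin (k.get i)) where
  toFun p := ⟨p.seg, p.pos⟩
  invFun p := ⟨p.1, p.2⟩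
  left_inv _ := rfl
  right_inv _ := rfl

instance Zig.fintype (k : List ℕ) : Fintype (Zig k) := Fintype.ofEquiv _ (Zig.equiv k).symm

/-- The 2-poset `X⋆(k)`: the bottom of each segment carries the label `y`, all other elements the
label `x`. -/
def XStar (k : List ℕ) : TwoPoset where
  carrier := Zig k
  label := fun p => if (p.pos : ℕ) = 0 then Letter.y else Letter.x

/-- `w⋆(k) = W(X⋆(k))`. -/
def wStar (k : List ℕ) : H := W (cls (XStar k))

/-! ### The `t`-adic objects -/

/-- For a function `Φ` of indices and `k = (k_1, …, k_r)`, the formal power series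
`∑_{l_1, …, l_r ≥ 0} ∏_j binom(k_j + l_j - 1, l_j) Φ(k_r + l_r, …, k_1 + l_1) t^{l_1 + ⋯ + l_r}`. -/
def revSeries {A : Type*} [AddCommMonoid A] (Φ : List ℕ → A) (k : List ℕ) : PowerSeries A :=
  PowerSeries.mk fun n =>
    ∑ l ∈ Finset.Nat.antidiagonalTuple k.length n,
      (∏ j, (k.get j + l j - 1).choose (l j)) •
        Φ (List.ofFn fun j => k.get j + l j).reverse

/-- `X⋆_Ŝ(k) = ∑_{i=0}^r (-1)^{k_{i+1} + ⋯ + k_r} X⋆(k_1, …, k_i) ⊔ ∑_{l_{i+1}, …, l_r ≥ 0}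
∏_j binom(k_j + l_j - 1, l_j) X⋆(k_r + l_r, …, k_{i+1} + l_{i+1}) t^{l_{i+1} + ⋯ + l_r}`
in `𝔓[[t]]`. -/
def XStarHat (k : List ℕ) : PowerSeries P :=
  ∑ i ∈ Finset.range (k.length + 1),
    (-1) ^ (k.drop i).sum *
      (PowerSeries.C (cls (XStar (k.take i))) * revSeries (fun m => cls (XStar m)) (k.drop i))

/-- `w⋆_Ŝ(k) = W(X⋆_Ŝ(k))`. -/
def wStarHat (k : List ℕ) : PowerSeries H := Wt (XStarHat k)

/-- The sum `∑_{j ≥ 0} F_j t^j` of power series `F_j`: the coefficient of `t^n` is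
`∑_{j=0}^n` of the coefficient of `t^{n-j}` in `F_j`. -/
def shiftSum (F : ℕ → PowerSeries H) : PowerSeries H :=
  PowerSeries.mk fun n => ∑ j ∈ Finset.range (n + 1), PowerSeries.coeff (n - j) (F j)

/-- The index `(a, k_{i+1}, …, k_r, k_1, …, k_{i-1}, b)`; here `i` is counted from `0`, so that
the omitted entry is `k.get i`. -/
def cyc (k : List ℕ) (i : ℕ) (a b : ℕ) : List ℕ :=
  a :: (k.drop (i + 1) ++ k.take i ++ [b])

/-- `w⋆_CSF(k) = ∑_{i=1}^r ∑_{j=0}^{k_i-2} w⋆(j+1, k_{i+1}, …, k_r, k_1, …, k_{i-1}, k_i - j)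
- k w⋆(k+1)`, where `k` is the weight. -/
def wCSF (k : List ℕ) : H :=
  (∑ i : Fin k.length, ∑ j ∈ Finset.range (k.get i - 1), wStar (cyc k i (j + 1) (k.get i - j)))
    - (k.sum : ℚ) • wStar [k.sum + 1]

/-- `w⋆_{CSF,Ŝ}(k) = ∑_{i=1}^r ∑_{j=0}^{k_i-2} w⋆_Ŝ(j+1, k_{i+1}, …, k_r, k_1, …, k_{i-1}, k_i - j)
- ∑_{i=1}^r ∑_{j≥0} w⋆_Ŝ(j+1, k_{i+1}, …, k_r, k_1, …, k_i) t^j - k w⋆_Ŝ(k+1)`. -/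
def wCSFHat (k : List ℕ) : PowerSeries H :=
  (∑ i : Fin k.length, ∑ j ∈ Finset.range (k.get i - 1), wStarHat (cyc k i (j + 1) (k.get i - j)))
    - (∑ i : Fin k.length, shiftSum fun j => wStarHat (cyc k i (j + 1) (k.get i)))
    - (k.sum : ℚ) • wStarHat [k.sum + 1]

end KYStar

end

noncomputable section

namespace KYStar

/-! Under the shuffle product ℌ becomes a commutative ring `Sh`, and W turns disjoint unions into
products. Hence w⋆_Ŝ of an index is an alternating sum over its cuts: the part before the cut times
the t-adic reversal of the part after it. Fix i and put κ = k_i, B = (k_{i+1}, …, k_r, k_1, …,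
k_{i-1}). The terms (j+1, B, κ-j) and (j+1, B, κ) t^j are treated according to the place of the cut.

Cut in the interior. The sum over j is a difference of two forks (`mid_identity`). A fork is a chain
y x^m whose bottom lies below the tops of two zigzags, and κ passes from one branch to the other.
Over all rotations these differences telescope (`sum_cutFork`), leaving forks with an empty branch,
which are series of ordinary w⋆(m+1, …).

Cut at an end. With nothing reversed one gets the terms of w⋆_CSF(k) and a series cancelling the
forks whose reversed branch is empty. With everything reversed, a purely binomial identity
(`revHat_identity`) gives the terms of the reversed w⋆_CSF and a series cancelling the other forks.
The multiples of w⋆(k+1) match by `nsmul_revHat_singleton`.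

The fork identity comes from shuffles of chains. Deleting the link between two neighbouring segments
gives a product, which is the linked poset plus the one with the link reversed, where the segments
fuse into one chain (`zigSum_cons`). Iterating, zigzags expand into chains through the linear
operators `zigOp`, and it remains to prove `sum_sh_chainWord`, obtained by sorting a shuffle by its
last y. Membership in ℌ¹ holds because every minimal element of a zigzag is labelled y. -/

/-! ### The shuffle product -/

/-- The word whose letters, read from the last to the first, form the given list. -/
def revWord : List Letter → H
  | [] => 1
  | a :: u => revWord u * var a

/-- The basis of `ℌ` consisting of the words, indexed by the reversed list of letters. -/
def wordBasis : Module.Basis (List Letter) ℚ H :=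
  (FreeAlgebra.basisFreeMonoid ℚ Letter).reindex
    (FreeMonoid.toList.trans ⟨List.reverse, List.reverse, List.reverse_reverse, List.reverse_reverse⟩)

theorem wordBasis_apply (u : List Letter) : wordBasis u = revWord u := by
  have h (w : FreeMonoid Letter) :
      FreeAlgebra.basisFreeMonoid ℚ Letter w = FreeMonoid.lift (FreeAlgebra.ι ℚ) w := by
    simp [FreeAlgebra.basisFreeMonoid, FreeAlgebra.equivMonoidAlgebraFreeMonoid]
  rw [wordBasis, Module.Basis.reindex_apply, h]
  induction u with
  | nil => rfl
  | cons a u ih =>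
    rw [revWord, ← ih]
    simp [FreeMonoid.lift_apply, var]

/-- The shuffle product of two words, given by their reversed lists of letters. -/
def shWord : List Letter → List Letter → H
  | [], v => revWord v
  | a :: u, [] => revWord (a :: u)
  | a :: u, b :: v => shWord u (b :: v) * var a + shWord (a :: u) v * var b
termination_by u v => u.length + v.length

/-- The shuffle product on `ℌ`. -/
def sh : H →ₗ[ℚ] H →ₗ[ℚ] H :=
  wordBasis.constr ℚ fun u => wordBasis.constr ℚ fun v => shWord u v

theorem sh_revWord (u v : List Letter) : sh (revWord u) (revWord v) = shWord u v := by
  rw [← wordBasis_apply, ← wordBasis_apply, sh, Module.Basis.constr_basis,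
    Module.Basis.constr_basis]

theorem word_ext {M : Type*} [AddCommGroup M] [Module ℚ M] {f g : H →ₗ[ℚ] M}
    (h : ∀ u, f (revWord u) = g (revWord u)) : f = g :=
  wordBasis.ext fun u => by rw [wordBasis_apply]; exact h u

theorem word_induction {p : H → Prop} (hw : ∀ u, p (revWord u)) (h0 : p 0)
    (ha : ∀ u v, p u → p v → p (u + v)) (hs : ∀ (c : ℚ) u, p u → p (c • u)) (u : H) : p u := by
  have h := wordBasis.span_eq.ge (Submodule.mem_top (x := u))
  refine Submodule.span_induction ?_ h0 (fun _ _ _ _ => ha _ _) (fun c _ _ => hs c _) h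
  rintro _ ⟨w, rfl⟩
  rw [wordBasis_apply]
  exact hw w

theorem sh_one_left (v : H) : sh 1 v = v := by
  have : sh 1 = LinearMap.id := word_ext fun v => by
    rw [← show revWord [] = 1 from rfl, sh_revWord, shWord]; rfl
  rw [this]; rfl

/-- Letters are peeled off on the right, since the last letter of a linear extension belongs to a
maximal element; with reversed lists it is the head. -/
theorem sh_mul_var (u v : H) (a b : Letter) :
    sh (u * var a) (v * var b) = sh u (v * var b) * var a + sh (u * var a) v * var b := by
  induction u using word_induction with
  | h0 => simp
  | ha u u' h h' => simp only [add_mul, map_add, LinearMap.add_apply, h, h']; abel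
  | hs c u h => simp only [smul_mul_assoc, map_smul, LinearMap.smul_apply, h, smul_add]
  | hw u =>
    induction v using word_induction with
    | h0 => simp
    | ha v v' h h' => simp only [add_mul, map_add, h, h']; abel
    | hs c v h => simp only [smul_mul_assoc, map_smul, h, smul_add]
    | hw v =>
      have e (u a) : revWord u * var a = revWord (a :: u) := rfl
      rw [e, e, sh_revWord, sh_revWord, sh_revWord, shWord]

theorem shWord_comm (u v : List Letter) : shWord u v = shWord v u := by
  induction u generalizing v with
  | nil => cases v <;> simp [shWord]
  | cons a u ihu =>
    induction v with
    | nil => simp [shWord]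
    | cons b v ihv => rw [shWord, shWord, ihu, ihv, add_comm]

theorem sh_comm (u v : H) : sh u v = sh v u := by
  have : sh = sh.flip := word_ext fun u => word_ext fun v => by
    rw [LinearMap.flip_apply, sh_revWord, sh_revWord, shWord_comm]
  exact LinearMap.congr_fun₂ this u v

theorem sh_one_right (v : H) : sh v 1 = v := by rw [sh_comm, sh_one_left]

theorem sh_assoc_revWord (u v w : List Letter) :
    sh (sh (revWord u) (revWord v)) (revWord w) = sh (revWord u) (sh (revWord v) (revWord w)) := by
  induction u generalizing v w with
  | nil => simp [revWord, sh_one_left]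
  | cons a u ihu =>
    induction v generalizing w with
    | nil => simp [revWord, sh_one_left, sh_one_right]
    | cons b v ihv =>
      induction w with
      | nil => simp [revWord, sh_one_right]
      | cons c w ihw =>
        have h1 := ihu (b :: v) (c :: w)
        have h2 := ihv (c :: w)
        simp only [revWord] at h1 h2 ihw ⊢
        simp only [sh_mul_var, map_add, LinearMap.add_apply] at h1 h2 ihw ⊢
        rw [h1, h2, ← ihw]
        simp only [add_mul]
        abel

theorem sh_assoc (u v w : H) : sh (sh u v) w = sh u (sh v w) := by
  induction u using word_induction with
  | h0 => simp
  | ha u u' h h' => simp only [map_add, LinearMap.add_apply, h, h']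
  | hs c u h => simp only [map_smul, LinearMap.smul_apply, h]
  | hw u =>
    induction v using word_induction with
    | h0 => simp
    | ha u u' h h' => simp only [map_add, LinearMap.add_apply, h, h']
    | hs c u h => simp only [map_smul, LinearMap.smul_apply, h]
    | hw v =>
      induction w using word_induction with
      | h0 => simp
      | ha u u' h h' => simp only [map_add, h, h']
      | hs c u h => simp only [map_smul, h]
      | hw w => exact sh_assoc_revWord u v w

/-- `ℌ` with the shuffle product. -/
def Sh : Type := H

instance : AddCommGroup Sh := inferInstanceAs (AddCommGroup H)
instance : Module ℚ Sh := inferInstanceAs (Module ℚ H)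

/-- The identity map from `ℌ` to the shuffle algebra. -/
def toSh : H ≃ₗ[ℚ] Sh := LinearEquiv.refl ℚ H

/-- A separate type keeps the shuffle product apart from concatenation, and its commutativity makes
`ring`, `module` and linearity over `Sh` available. -/
instance : CommRing Sh :=
  { (inferInstance : AddCommGroup Sh) with
    mul := fun u v => toSh (sh (toSh.symm u) (toSh.symm v))
    one := toSh 1
    mul_assoc := fun u v w => sh_assoc u v w
    one_mul := fun u => sh_one_left u
    mul_one := fun u => sh_one_right u
    left_distrib := fun u v w => map_add (sh u) v w
    right_distrib := fun u v w => LinearMap.map_add₂ sh u v w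
    mul_comm := fun u v => sh_comm u v
    zero_mul := fun u => LinearMap.map_zero₂ sh u
    mul_zero := fun u => map_zero (sh u) }

theorem toSh_sh (u v : H) : toSh (sh u v) = toSh u * toSh v := rfl

theorem toSh_one : toSh 1 = 1 := rfl

/-! ### Linear extensions of labelled relations -/

section LinearExtensions

open scoped Classical

variable {α β : Type}

/-- The enumeration `g` of the finite set `S` is compatible with the relation `R`. -/
def IsLinExt (R : α → α → Prop) (S : Finset α) {n : ℕ} (g : Fin n → α) : Prop :=
  Function.Injective g ∧ (∀ p, p ∈ S ↔ ∃ i, g i = p) ∧ ∀ i j, R (g i) (g j) → i ≤ j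

/-- `R` is an arbitrary relation, not an order, so that single generating relations can later be
added or removed without forming transitive closures. -/
theorem isLinExt_snoc {R : α → α → Prop} {S : Finset α} {n : ℕ} (g : Fin n → α) (m : α) :
    IsLinExt R S (Fin.snoc g m : Fin (n + 1) → α) ↔
      (m ∈ S ∧ ∀ q ∈ S, R m q → q = m) ∧ IsLinExt R (S.erase m) g := by
  constructor
  · rintro ⟨h1, h2, h3⟩
    have hm (i : Fin n) : g i ≠ m := fun h => by
      have := @h1 i.castSucc (Fin.last n) (by simpa using h)
      exact absurd this (Fin.castSucc_lt_last i).ne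
    refine ⟨⟨(h2 m).2 ⟨Fin.last n, by simp⟩, fun q hq h => ?_⟩, ?_, fun p => ?_, fun i j h => ?_⟩
    · obtain ⟨i, rfl⟩ := (h2 q).1 hq
      have := h3 (Fin.last n) i (by simpa using h)
      rw [Fin.last_le_iff.1 this]
      simp
    · intro i j h
      have := @h1 i.castSucc j.castSucc (by simpa using h)
      exact Fin.castSucc_injective n this
    · rw [Finset.mem_erase, h2, Fin.exists_fin_succ']
      simp only [Fin.snoc_castSucc, Fin.snoc_last]
      constructor
      · rintro ⟨hp, h | h⟩
        · exact h
        · exact absurd h.symm hp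
      · rintro ⟨i, rfl⟩
        exact ⟨hm i, Or.inl ⟨i, rfl⟩⟩
    · have := h3 i.castSucc j.castSucc (by simpa using h)
      simpa using this
  · rintro ⟨⟨hm, hmax⟩, h1, h2, h3⟩
    have hne (i : Fin n) : g i ≠ m := ((S.mem_erase).1 ((h2 _).2 ⟨i, rfl⟩)).1
    refine ⟨?_, fun p => ?_, fun i j => ?_⟩
    · intro i j
      cases i using Fin.lastCases <;> cases j using Fin.lastCases <;>
        simp only [Fin.snoc_castSucc, Fin.snoc_last]
      · exact fun _ => trivial
      · exact fun h => absurd h.symm (hne _)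
      · exact fun h => absurd h (hne _)
      · exact fun h => congrArg _ (h1 h)
    · rw [Fin.exists_fin_succ']
      simp only [Fin.snoc_castSucc, Fin.snoc_last]
      rw [← h2, Finset.mem_erase]
      by_cases hp : p = m
      · simp [hp, hm]
      · simp [hp, Ne.symm hp]
    · cases i using Fin.lastCases with
      | last =>
        cases j using Fin.lastCases with
        | last => exact fun _ => le_rfl
        | cast j =>
          simp only [Fin.snoc_castSucc, Fin.snoc_last]
          exact fun h => absurd (hmax _ (Finset.mem_of_mem_erase ((h2 _).2 ⟨j, rfl⟩)) h) (hne j)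
      | cast i =>
        cases j using Fin.lastCases with
        | last => exact fun _ => Fin.le_last _
        | cast j =>
          simp only [Fin.snoc_castSucc]
          exact fun h => h3 i j h

variable [Fintype α] [Fintype β]

/-- The sum of the words of all bijections `α → {1, …, n}` which are compatible with the
relation `R`. -/
def orderSum (R : α → α → Prop) (l : α → Letter) (n : ℕ) : H :=
  ∑ f : α ≃ Fin n with ∀ p q, R p q → f p ≤ f q, (List.ofFn fun i => var (l (f.symm i))).prod

/-- The sum of the words of all enumerations of `S` which are compatible with `R`. -/
def linExtSum (R : α → α → Prop) (l : α → Letter) (S : Finset α) (n : ℕ) : H :=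
  ∑ g : Fin n → α with IsLinExt R S g, (List.ofFn fun i => var (l (g i))).prod

theorem orderSum_eq_linExtSum (R : α → α → Prop) (l : α → Letter) (n : ℕ) :
    orderSum R l n = linExtSum R l Finset.univ n := by
  refine Finset.sum_bij (fun f _ => f.symm) ?_ ?_ ?_ ?_
  · intro f hf
    simp only [Finset.mem_filter, Finset.mem_univ, true_and] at hf ⊢
    refine ⟨f.symm.injective, fun p => ⟨fun _ => ⟨f p, f.symm_apply_apply p⟩, fun _ => Finset.mem_univ _⟩,
      fun i j h => ?_⟩
    simpa using hf _ _ h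
  · intro f _ f' _ h
    exact Equiv.symm_bijective.injective (DFunLike.coe_injective h)
  · intro g hg
    simp only [Finset.mem_filter, Finset.mem_univ, true_and] at hg
    obtain ⟨h1, h2, h3⟩ := hg
    let e := Equiv.ofBijective g ⟨h1, fun p => (h2 p).1 (Finset.mem_univ p)⟩
    refine ⟨e.symm, ?_, rfl⟩
    simp only [Finset.mem_filter, Finset.mem_univ, true_and]
    intro p q h
    apply h3
    have e1 (p) : g (e.symm p) = p := e.apply_symm_apply p
    rwa [e1, e1]
  · intro f _
    rfl

theorem linExtSum_succ (R : α → α → Prop) (l : α → Letter) (S : Finset α) (n : ℕ) :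
    linExtSum R l S (n + 1) =
      ∑ m ∈ S with ∀ q ∈ S, R m q → q = m, linExtSum R l (S.erase m) n * var (l m) := by
  unfold linExtSum
  simp_rw [Finset.sum_mul]
  rw [Finset.sum_sigma']
  symm
  refine Finset.sum_bij (fun x _ => (Fin.snoc x.2 x.1 : Fin (n + 1) → α)) ?_ ?_ ?_ ?_
  · rintro ⟨m, g⟩ h
    simp only [Finset.mem_sigma, Finset.mem_filter, Finset.mem_univ, true_and] at h ⊢
    exact (isLinExt_snoc g m).2 h
  · rintro ⟨m, g⟩ _ ⟨m', g'⟩ _ h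
    obtain ⟨rfl, rfl⟩ := Fin.snoc_injective2 h
    rfl
  · intro g hg
    rw [← Fin.snoc_init_self g] at hg
    simp only [Finset.mem_filter, Finset.mem_univ, true_and] at hg
    refine ⟨⟨g (Fin.last n), Fin.init g⟩, ?_, Fin.snoc_init_self g⟩
    simp only [Finset.mem_sigma, Finset.mem_filter, Finset.mem_univ, true_and]
    exact (isLinExt_snoc (Fin.init g) (g (Fin.last n))).1 hg
  · rintro ⟨m, g⟩ _
    rw [List.ofFn_succ', List.concat_eq_append, List.prod_append]
    simp

theorem linExtSum_empty (R : α → α → Prop) (l : α → Letter) : linExtSum R l ∅ 0 = 1 := by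
  unfold linExtSum
  rw [Finset.sum_eq_single (fun i => i.elim0)]
  · simp
  · intro g _ h
    exact absurd (funext fun i => i.elim0) h
  · intro h
    simp only [Finset.mem_filter, Finset.mem_univ, true_and] at h
    exact absurd ⟨fun i => i.elim0, by simp, fun i => i.elim0⟩ h

theorem linExtSum_card (R : α → α → Prop) (l : α → Letter) (S : Finset α) (hS : S.Nonempty) :
    linExtSum R l S S.card =
      ∑ m ∈ S with ∀ q ∈ S, R m q → q = m,
        linExtSum R l (S.erase m) (S.erase m).card * var (l m) := by
  obtain ⟨n, hn⟩ : ∃ n, S.card = n + 1 := ⟨S.card - 1, (Nat.sub_add_cancel hS.card_pos).symm⟩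
  rw [hn, linExtSum_succ]
  refine Finset.sum_congr rfl fun m hm => ?_
  rw [Finset.card_erase_of_mem (Finset.mem_filter.1 hm).1, hn, Nat.add_sub_cancel]

theorem sh_sum_mul_var {ι κ : Type*} (s : Finset ι) (t : Finset κ) (u : ι → H) (v : κ → H)
    (a : ι → Letter) (b : κ → Letter) :
    sh (∑ i ∈ s, u i * var (a i)) (∑ j ∈ t, v j * var (b j)) =
      ∑ i ∈ s, sh (u i) (∑ j ∈ t, v j * var (b j)) * var (a i) +
        ∑ j ∈ t, sh (∑ i ∈ s, u i * var (a i)) (v j) * var (b j) := by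
  simp only [map_sum, LinearMap.sum_apply, sh_mul_var, Finset.sum_add_distrib, Finset.sum_mul]
  congr 1
  exact Finset.sum_comm

/-- A maximal element of a disjoint union is maximal in one of the components; the two cases are the
two terms of the shuffle recursion. -/
theorem linExtSum_disjSum (R : α → α → Prop) (R' : β → β → Prop) (l : α → Letter)
    (l' : β → Letter) (n : ℕ) (S : Finset α) (T : Finset β) (hn : S.card + T.card = n) :
    linExtSum (Sum.LiftRel R R') (Sum.elim l l') (S.disjSum T) n =
      sh (linExtSum R l S S.card) (linExtSum R' l' T T.card) := by
  induction n generalizing S T with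
  | zero =>
    obtain rfl : S = ∅ := Finset.card_eq_zero.1 (by omega)
    obtain rfl : T = ∅ := Finset.card_eq_zero.1 (by omega)
    rw [Finset.disjSum_empty, Finset.map_empty, Finset.card_empty, Finset.card_empty,
      linExtSum_empty, linExtSum_empty, linExtSum_empty, sh_one_left]
  | succ n ih =>
    have hL : linExtSum (Sum.LiftRel R R') (Sum.elim l l') (S.disjSum T) (n + 1) =
        ∑ m ∈ S with ∀ q ∈ S, R m q → q = m,
          sh (linExtSum R l (S.erase m) (S.erase m).card) (linExtSum R' l' T T.card) * var (l m) +
        ∑ m ∈ T with ∀ q ∈ T, R' m q → q = m,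
          sh (linExtSum R l S S.card) (linExtSum R' l' (T.erase m) (T.erase m).card) *
            var (l' m) := by
      rw [linExtSum_succ, Finset.sum_filter, Finset.sum_disjSum, Finset.sum_filter,
        Finset.sum_filter]
      congr 1
      · refine Finset.sum_congr rfl fun m hm => ?_
        have h1 : (∀ q ∈ S.disjSum T, Sum.LiftRel R R' (Sum.inl m) q → q = Sum.inl m) ↔
            ∀ q ∈ S, R m q → q = m := by
          simp
        have h2 (_ : DecidableEq (α ⊕ β)) : (S.disjSum T).erase (Sum.inl m) = (S.erase m).disjSum T := by
          ext (q | q) <;> simp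
        simp only [h1, h2]
        split_ifs with h
        · rw [ih _ _ (by rw [Finset.card_erase_of_mem hm]; have := Finset.card_pos.2 ⟨m, hm⟩; omega)]
          rfl
        · rfl
      · refine Finset.sum_congr rfl fun m hm => ?_
        have h1 : (∀ q ∈ S.disjSum T, Sum.LiftRel R R' (Sum.inr m) q → q = Sum.inr m) ↔
            ∀ q ∈ T, R' m q → q = m := by
          simp
        have h2 (_ : DecidableEq (α ⊕ β)) : (S.disjSum T).erase (Sum.inr m) = S.disjSum (T.erase m) := by
          ext (q | q) <;> simp
        simp only [h1, h2]
        split_ifs with h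
        · rw [ih _ _ (by rw [Finset.card_erase_of_mem hm]; have := Finset.card_pos.2 ⟨m, hm⟩; omega)]
          rfl
        · rfl
    rw [hL]
    -- The shuffle recursion needs a last letter on both sides, so an empty side, whose sum is `1`,
    -- is treated apart.
    rcases S.eq_empty_or_nonempty with rfl | hS
    · simp only [Finset.filter_empty, Finset.sum_empty, zero_add, Finset.card_empty,
        linExtSum_empty, sh_one_left]
      rw [← linExtSum_card R' l' T (Finset.card_pos.1 (by simp at hn; omega))]
    rcases T.eq_empty_or_nonempty with rfl | hT
    · simp only [Finset.filter_empty, Finset.sum_empty, add_zero, Finset.card_empty,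
        linExtSum_empty, sh_one_right]
      rw [← linExtSum_card R l S hS]
    rw [linExtSum_card R l S hS, linExtSum_card R' l' T hT, sh_sum_mul_var]

theorem orderSum_sum (R : α → α → Prop) (R' : β → β → Prop) (l : α → Letter) (l' : β → Letter)
    {n m : ℕ} (hn : Fintype.card α = n) (hm : Fintype.card β = m) :
    orderSum (Sum.LiftRel R R') (Sum.elim l l') (n + m) =
      sh (orderSum R l n) (orderSum R' l' m) := by
  subst hn hm
  simp only [orderSum_eq_linExtSum, ← Finset.card_univ]
  rw [← linExtSum_disjSum R R' l l' _ _ _ rfl, Finset.univ_disjSum_univ]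

theorem orderSum_congr (e : α ≃ β) {R : α → α → Prop} {R' : β → β → Prop} {l : α → Letter}
    {l' : β → Letter} (n : ℕ) (hl : ∀ p, l' (e p) = l p)
    (h : ∀ f : β ≃ Fin n, (∀ p q, R p q → f (e p) ≤ f (e q)) ↔ ∀ p q, R' p q → f p ≤ f q) :
    orderSum R l n = orderSum R' l' n := by
  refine Finset.sum_equiv (e.equivCongr (Equiv.refl _)) ?_ ?_
  · intro f
    simp only [Finset.mem_filter, Finset.mem_univ, true_and]
    rw [← h]
    simp
  · intro f _
    congr 2
    funext i
    rw [← hl]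
    rfl

/-- A bijection places distinct `a` and `b` in exactly one of the two orders. -/
theorem orderSum_split (R : α → α → Prop) (l : α → Letter) (n : ℕ) {a b : α} (hab : a ≠ b) :
    orderSum R l n = orderSum (fun p q => R p q ∨ (p = a ∧ q = b)) l n +
      orderSum (fun p q => R p q ∨ (p = b ∧ q = a)) l n := by
  unfold orderSum
  rw [← Finset.sum_filter_add_sum_filter_not _ (fun f : α ≃ Fin n => f a ≤ f b),
    Finset.filter_filter, Finset.filter_filter]
  congr 1
  · refine Finset.sum_congr ?_ fun _ _ => rfl
    ext f
    simp only [Finset.mem_filter, Finset.mem_univ, true_and]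
    constructor
    · rintro ⟨h, h'⟩ p q (hR | ⟨rfl, rfl⟩)
      exacts [h _ _ hR, h']
    · exact fun h => ⟨fun p q hR => h _ _ (Or.inl hR), h _ _ (Or.inr ⟨rfl, rfl⟩)⟩
  · refine Finset.sum_congr ?_ fun _ _ => rfl
    ext f
    simp only [Finset.mem_filter, Finset.mem_univ, true_and]
    constructor
    · rintro ⟨h, h'⟩ p q (hR | ⟨rfl, rfl⟩)
      exacts [h _ _ hR, (not_le.1 h').le]
    · exact fun h => ⟨fun p q hR => h _ _ (Or.inl hR), fun h' =>
        hab (f.injective (le_antisymm h' (h _ _ (Or.inr ⟨rfl, rfl⟩))))⟩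

end LinearExtensions

theorem TwoPoset.W_eq_orderSum (X : TwoPoset) :
    X.W = orderSum (· ≤ ·) X.label (Fintype.card X.carrier) := rfl

theorem TwoPoset.W_disj (X Y : TwoPoset) : (X.disj Y).W = sh X.W Y.W := by
  rw [W_eq_orderSum, W_eq_orderSum, W_eq_orderSum, ← orderSum_sum _ _ _ _ rfl rfl]
  have : Fintype.card (X.disj Y).carrier = Fintype.card X.carrier + Fintype.card Y.carrier :=
    Fintype.card_sum
  rw [this]
  rfl

/-! ### Path-shaped posets -/

/-- The word `y x^n`. -/
def chainWord (n : ℕ) : H := var Letter.y * var Letter.x ^ n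

/-- The letters of a segment of length `k`, from top to bottom. -/
def segment (k : ℕ) : List Letter := List.replicate (k - 1) Letter.x ++ [Letter.y]

theorem revWord_append (u v : List Letter) : revWord (u ++ v) = revWord v * revWord u := by
  induction u with
  | nil => simp [revWord]
  | cons a u ih => rw [List.cons_append, revWord, ih, revWord, mul_assoc]

theorem revWord_segment (k : ℕ) : revWord (segment k) = chainWord (k - 1) := by
  have h (n : ℕ) : revWord (List.replicate n Letter.x) = var Letter.x ^ n := by
    induction n with
    | zero => rfl
    | succ n ih => rw [List.replicate_succ, revWord, ih, pow_succ]
  rw [segment, revWord_append, h]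
  simp [revWord, chainWord]

theorem length_segment {k : ℕ} (hk : 0 < k) : (segment k).length = k := by
  simp [segment]; omega

/-- Consecutive elements `i, i + 1` of a path are related upwards if `asc i` holds, and downwards
if `desc i` holds. -/
def pathRel (asc desc : ℕ → Prop) {n : ℕ} (p q : Fin n) : Prop :=
  ((q : ℕ) = p + 1 ∧ asc p) ∨ ((p : ℕ) = q + 1 ∧ desc q)

/-- The sum of the words of all linear extensions of a path. -/
def pathSum (n : ℕ) (lab : ℕ → Letter) (asc desc : ℕ → Prop) : H :=
  orderSum (pathRel asc desc) (fun p : Fin n => lab p) n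

/-- Position `n`, counted from top to bottom and from left to right, is the bottom of a segment. -/
def isBot : List ℕ → ℕ → Prop
  | [], _ => False
  | k :: A, n => if n < k then n + 1 = k else isBot A (n - k)

open Classical in
/-- The label of position `n`. -/
def zigLabel (A : List ℕ) (n : ℕ) : Letter := if isBot A n then Letter.y else Letter.x

/-- The labels of the path consisting of the chain `u` and the segments of `A`. -/
def pathLabel (u : List Letter) (A : List ℕ) (n : ℕ) : Letter :=
  if h : n < u.length then u[n] else zigLabel A (n - u.length)

/-- The sum of the words of the path consisting of the chain `c` and the segments of `A`. -/
def zigSum (c : List Letter) (A : List ℕ) : H :=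
  pathSum (c.length + A.sum) (pathLabel c A) (isBot (c.length :: A))
    fun n => ¬ isBot (c.length :: A) n

theorem pathSum_congr {n n' : ℕ} (hn : n = n') {lab lab' : ℕ → Letter}
    {asc asc' desc desc' : ℕ → Prop} (hl : ∀ i < n, lab i = lab' i)
    (ha : ∀ i, i + 1 < n → (asc i ↔ asc' i)) (hd : ∀ i, i + 1 < n → (desc i ↔ desc' i)) :
    pathSum n lab asc desc = pathSum n' lab' asc' desc' := by
  subst hn
  refine orderSum_congr (Equiv.refl _) n (fun p => (hl p p.2).symm) fun f => ?_
  refine forall₂_congr fun p q => ?_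
  have : pathRel asc desc p q ↔ pathRel asc' desc' p q := by
    refine or_congr (and_congr_right fun h => ha _ ?_) (and_congr_right fun h => hd _ ?_)
    · rw [← h]; exact q.2
    · rw [← h]; exact p.2
  rw [this]
  rfl

theorem pathSum_split {n : ℕ} (lab : ℕ → Letter) {asc desc : ℕ → Prop} {i : ℕ} (hi : i + 1 < n) :
    pathSum n lab asc desc = pathSum n lab (fun j => asc j ∨ j = i) desc +
      pathSum n lab asc fun j => desc j ∨ j = i := by
  unfold pathSum
  rw [orderSum_split _ _ n (a := ⟨i, Nat.lt_of_succ_lt hi⟩) (b := ⟨i + 1, hi⟩)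
    (by simp [Fin.ext_iff])]
  congr 1
  · refine orderSum_congr (Equiv.refl _) n (fun p => rfl) fun f => forall₂_congr fun p q => ?_
    refine imp_congr ?_ Iff.rfl
    simp only [pathRel, Fin.ext_iff]
    grind
  · refine orderSum_congr (Equiv.refl _) n (fun p => rfl) fun f => forall₂_congr fun p q => ?_
    refine imp_congr ?_ Iff.rfl
    simp only [pathRel, Fin.ext_iff]
    grind

theorem pathSum_add {n m : ℕ} (lab : ℕ → Letter) {asc desc : ℕ → Prop}
    (ha : ∀ i, i + 1 = n → ¬ asc i) (hd : ∀ i, i + 1 = n → ¬ desc i) :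
    pathSum (n + m) lab asc desc =
      sh (pathSum n lab asc desc)
        (pathSum m (fun i => lab (n + i)) (fun i => asc (n + i)) fun i => desc (n + i)) := by
  unfold pathSum
  rw [← orderSum_sum _ _ _ _ (Fintype.card_fin n) (Fintype.card_fin m)]
  symm
  refine orderSum_congr finSumFinEquiv _ ?_ fun f => ?_
  · rintro (p | p) <;> simp
  · rw [← finSumFinEquiv.forall_congr_right]
    refine forall_congr' fun p => ?_
    rw [← finSumFinEquiv.forall_congr_right]
    refine forall_congr' fun q => imp_congr ?_ Iff.rfl
    rcases p with p | p <;> rcases q with q | q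
    · simp [pathRel]
    · have := p.2
      simp only [pathRel, finSumFinEquiv_apply_left, finSumFinEquiv_apply_right,
        Sum.not_liftRel_inl_inr, false_iff, Fin.val_castAdd, Fin.val_natAdd]
      rintro (⟨h, h'⟩ | ⟨h, h'⟩)
      · exact ha _ (by omega) h'
      · omega
    · have := q.2
      simp only [pathRel, finSumFinEquiv_apply_left, finSumFinEquiv_apply_right,
        Sum.not_liftRel_inr_inl, false_iff, Fin.val_castAdd, Fin.val_natAdd]
      rintro (⟨h, h'⟩ | ⟨h, h'⟩)
      · omega
      · exact hd _ (by omega) h'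
    · simp only [pathRel, finSumFinEquiv_apply_right, Fin.val_natAdd, Sum.liftRel_inr_inr]
      grind

theorem revWord_eq_prod (u : List Letter) : revWord u = (u.map var).reverse.prod := by
  induction u with
  | nil => rfl
  | cons a u ih => rw [revWord, ih]; simp

/-- Composed with `Fin.rev`, `f` is strictly increasing and surjective, hence the identity: a
descending chain has only one linear extension. -/
theorem eq_revPerm {n : ℕ} {f : Fin n ≃ Fin n}
    (h : ∀ p q : Fin n, (p : ℕ) = q + 1 → f p ≤ f q) : f = Fin.revPerm := by
  cases n with
  | zero => ext i; exact i.elim0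
  | succ n =>
    have h1 : StrictMono fun i => Fin.rev (f i) := by
      refine Fin.strictMono_iff_lt_succ.2 fun i => Fin.rev_lt_rev.2 (lt_of_le_of_ne (h _ _ (by simp)) ?_)
      rw [Ne, f.apply_eq_iff_eq]
      exact (Fin.castSucc_lt_succ).ne'
    have h2 := (h1.range_inj strictMono_id).1 (by
      rw [(show Function.Surjective fun i => Fin.rev (f i) from
        Fin.rev_surjective.comp f.surjective).range_eq]
      simp)
    ext i : 1
    rw [Fin.revPerm_apply, ← Fin.rev_eq_iff]
    exact congrFun h2 i

theorem pathSum_desc (u : List Letter) {lab : ℕ → Letter}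
    (hl : ∀ i (h : i < u.length), lab i = u[i]) {asc desc : ℕ → Prop}
    (ha : ∀ i, i + 1 < u.length → ¬ asc i) (hd : ∀ i, i + 1 < u.length → desc i) :
    pathSum u.length lab asc desc = revWord u := by
  unfold pathSum orderSum
  rw [Finset.sum_eq_single_of_mem Fin.revPerm]
  · rw [revWord_eq_prod]
    congr 1
    refine List.ext_getElem (by simp) fun i h1 h2 => ?_
    simp only [List.getElem_ofFn, List.getElem_reverse, List.getElem_map]
    rw [hl]
    · simp
      congr 2
      omega
    · simp at h1 h2 ⊢
      omega
  · simp only [Finset.mem_filter, Finset.mem_univ, true_and]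
    rintro p q (⟨h, h'⟩ | ⟨h, h'⟩)
    · exact absurd h' (ha _ (h ▸ q.2))
    · rw [Fin.revPerm_apply, Fin.revPerm_apply, Fin.rev_le_rev, Fin.le_def]
      omega
  · intro f hf hne
    simp only [Finset.mem_filter, Finset.mem_univ, true_and] at hf
    exact absurd (eq_revPerm fun p q h => hf p q (Or.inr ⟨h, hd _ (h ▸ p.2)⟩)) hne

theorem zigSum_nil (c : List Letter) : zigSum c [] = revWord c := by
  unfold zigSum
  refine pathSum_desc c (fun i h => by simp [pathLabel, h]) (fun i h => ?_) fun i h => ?_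
  all_goals
    simp [isBot, show i < c.length by omega]
    omega

theorem zigLabel_cons {k : ℕ} (hk : 0 < k) (A : List ℕ) (i : ℕ) :
    pathLabel (segment k) A i = zigLabel (k :: A) i := by
  unfold pathLabel zigLabel
  have := length_segment hk
  by_cases h : i < k
  · have e : isBot (k :: A) i ↔ i + 1 = k := by simp [isBot, h]
    rw [dif_pos (by omega)]
    simp only [e, segment, List.getElem_append, List.getElem_replicate, List.length_replicate]
    grind
  · have e : isBot (k :: A) i ↔ isBot A (i - k) := by simp [isBot, h]
    rw [dif_neg (by omega), this]
    classical exact if_congr e.symm rfl rfl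

/-- Without the relation between the bottom of `c` (position `c.length - 1`) and the top of the next
segment, the path falls into two components and gives a shuffle. Restoring that relation upwards
gives the zigzag; downwards it fuses the segment onto the bottom of `c`. -/
theorem zigSum_cons {c : List Letter} (hc : c ≠ []) {k : ℕ} (hk : 0 < k) (A : List ℕ) :
    zigSum c (k :: A) = sh (revWord c) (zigSum (segment k) A) - zigSum (c ++ segment k) A := by
  have hc' := List.length_pos_iff.2 hc
  rw [eq_sub_iff_add_eq]
  have hlab (i : ℕ) := zigLabel_cons hk A i
  have h := pathSum_add (n := c.length) (m := k + A.sum) (pathLabel c (k :: A))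
    (asc := fun i => isBot (c.length :: k :: A) i ∧ i + 1 ≠ c.length)
    (desc := fun i => ¬ isBot (c.length :: k :: A) i) (by grind)
    (by intro i hi; simp [isBot, hi, show i < c.length by omega])
  rw [pathSum_desc c (by intro i h; simp [pathLabel, h])
    (by intro i h; simp [isBot, show i < c.length by omega])
    (by intro i h; simp [isBot, show i < c.length by omega]; omega),
    pathSum_split _ (i := c.length - 1) (by omega)] at h
  unfold zigSum
  refine Eq.trans (congrArg₂ _ ?_ ?_) (h.trans (congrArg _ ?_))
  · refine pathSum_congr (by simp) (fun _ _ => rfl) (fun i hi => ?_) fun _ _ => Iff.rfl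
    simp only [isBot]
    grind
  · refine pathSum_congr (by simp [length_segment hk]; omega) (fun i hi => ?_) (fun i hi => ?_)
      fun i hi => ?_
    · have := hlab (i - c.length)
      unfold pathLabel at this ⊢
      simp only [List.length_append, length_segment hk] at this ⊢
      grind
    · simp only [isBot, List.length_append, length_segment hk]
      grind
    · simp only [isBot, List.length_append, length_segment hk]
      grind
  · refine pathSum_congr (by rw [length_segment hk]) (fun i hi => ?_) (fun i hi => ?_)
      fun i hi => ?_
    · rw [hlab]
      simp [pathLabel]
    · simp only [isBot, length_segment hk]
      grind
    · simp only [isBot, length_segment hk]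
      grind

/-! ### The recursion for `w⋆` -/

/-- The sum of the words of the poset consisting of a chain with word `c` whose bottom lies below
the top of the zigzag of `A`. -/
def linkSum : List ℕ → H → H
  | [], c => c
  | k :: A, c => sh c (linkSum A (chainWord (k - 1))) - linkSum A (chainWord (k - 1) * c)

/-- The recursive description of `w⋆`. -/
def zigWord : List ℕ → H
  | [] => 1
  | k :: A => linkSum A (chainWord (k - 1))

theorem zigSum_eq_linkSum {c : List Letter} (hc : c ≠ []) {A : List ℕ} (hA : ∀ a ∈ A, 0 < a) :
    zigSum c A = linkSum A (revWord c) := by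
  induction A generalizing c with
  | nil => exact zigSum_nil c
  | cons k A ih =>
    have hA' : ∀ a ∈ A, 0 < a := fun a ha => hA a (List.mem_cons_of_mem _ ha)
    rw [zigSum_cons hc (hA k List.mem_cons_self), ih (by simp [segment]) hA',
      ih (by simp [hc]) hA', revWord_append, revWord_segment, linkSum]

theorem isBot_cons_add (k : ℕ) (A : List ℕ) (n : ℕ) : isBot (k :: A) (k + n) ↔ isBot A n := by
  simp [isBot]

theorem isBot_sum_take (k : List ℕ) (i : ℕ) (hi : i < k.length) (b : ℕ) (hb : b < k[i]) :
    isBot k ((k.take i).sum + b) ↔ b + 1 = k[i] := by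
  induction k generalizing i with
  | nil => simp at hi
  | cons a k ih =>
    cases i with
    | zero => simpa [isBot] using fun h => absurd hb (by simpa using h)
    | succ i =>
      have := ih i (by simpa using hi) (by simpa using hb)
      rw [List.take_succ_cons, List.sum_cons, add_assoc, isBot_cons_add, this,
        List.getElem_cons_succ]

theorem sum_univ_get_take (k : List ℕ) (i : ℕ) (hi : i ≤ k.length) :
    ∑ j : Fin i, k.get (j.castLE hi) = (k.take i).sum := by
  induction i with
  | zero => simp
  | succ i ih =>
    rw [Fin.sum_univ_castSucc, List.take_succ_eq_append_getElem hi, List.sum_append, ← ih (by omega)]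
    simp

/-- The enumeration of the zigzag from top to bottom and from left to right. -/
def zigEquiv (k : List ℕ) : Zig k ≃ Fin k.sum :=
  -- Positions in `Zig` count from the bottom, those of the path from the top, whence `Fin.revPerm`.
  (Zig.equiv k).trans ((Equiv.sigmaCongrRight fun _ => Fin.revPerm).trans
    (finSigmaFinEquiv.trans (finCongr ((sum_univ_get_take k k.length le_rfl).trans (by simp)))))

theorem zigEquiv_val {k : List ℕ} (i : Fin k.length) (a : Fin (k.get i)) :
    (zigEquiv k ⟨i, a⟩ : ℕ) = (k.take i).sum + (k.get i - (a + 1)) := by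
  rw [← sum_univ_get_take k i i.2.le]
  simp only [zigEquiv, Equiv.trans_apply, finCongr_apply, Fin.val_cast, finSigmaFinEquiv_apply]
  rfl

theorem isBot_zigEquiv {k : List ℕ} (p : Zig k) : isBot k (zigEquiv k p) ↔ (p.pos : ℕ) = 0 := by
  obtain ⟨i, a⟩ := p
  have := a.2
  have h : k.get i = k[(i : ℕ)] := rfl
  rw [zigEquiv_val, isBot_sum_take k i i.2 (k.get i - (a + 1)) (by omega), ← h]
  simp only
  omega

theorem pathRel_of_edge {k : List ℕ} {p q : Zig k} (h : Zig.Edge p q) :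
    pathRel (isBot k) (fun i => ¬ isBot k i) (zigEquiv k p) (zigEquiv k q) := by
  simp only [pathRel]
  rw [isBot_zigEquiv, isBot_zigEquiv]
  cases h with
  | chain i a b h =>
    refine Or.inr ⟨?_, by simp only; omega⟩
    rw [zigEquiv_val, zigEquiv_val]
    have := b.2
    omega
  | link i j a b hij ha hb =>
    refine Or.inl ⟨?_, ha⟩
    rw [zigEquiv_val, zigEquiv_val, hij, List.take_succ_eq_append_getElem i.2, List.sum_append]
    have := a.2
    simp
    grind

/-- Positivity matters: across an empty segment the path would relate two segments that no edge
joins. -/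
theorem edge_of_pathRel {k : List ℕ} (hk : ∀ a ∈ k, 0 < a) {p q : Zig k}
    (h : pathRel (isBot k) (fun i => ¬ isBot k i) (zigEquiv k p) (zigEquiv k q)) :
    Zig.Edge p q := by
  simp only [pathRel] at h
  rw [isBot_zigEquiv, isBot_zigEquiv] at h
  obtain ⟨i, a⟩ := p
  obtain ⟨j, b⟩ := q
  rcases h with ⟨h, h0⟩ | ⟨h, h0⟩
  · have hlt := (zigEquiv k ⟨j, b⟩).2
    have e : (zigEquiv k ⟨i, a⟩ : ℕ) + 1 = (k.take (i + 1)).sum := by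
      rw [zigEquiv_val, List.take_succ_eq_append_getElem i.2, List.sum_append]
      have := a.2
      simp
      grind
    have hi : (i : ℕ) + 1 < k.length := by
      by_contra hi
      rw [List.take_of_length_le (by omega)] at e
      omega
    have hpos : 0 < k.get ⟨i + 1, hi⟩ := hk _ (List.get_mem _ _)
    have : (⟨j, b⟩ : Zig k) = ⟨⟨i + 1, hi⟩, ⟨k.get ⟨i + 1, hi⟩ - 1, by omega⟩⟩ := by
      apply (zigEquiv k).injective
      ext
      rw [h, e, zigEquiv_val]
      simp only
      omega
    rw [this]
    exact Zig.Edge.link _ _ _ _ rfl h0 (by simp only; omega)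
  · have hb := b.2
    have : (⟨i, a⟩ : Zig k) = ⟨j, ⟨b - 1, by omega⟩⟩ := by
      apply (zigEquiv k).injective
      ext
      rw [h, zigEquiv_val, zigEquiv_val]
      simp only at h0 ⊢
      omega
    rw [this]
    exact Zig.Edge.chain _ _ _ (by simp only at h0 ⊢; omega)

theorem wStar_eq_pathSum {k : List ℕ} (hk : ∀ a ∈ k, 0 < a) :
    wStar k = pathSum k.sum (zigLabel k) (isBot k) fun i => ¬ isBot k i := by
  have hc : Fintype.card (XStar k).carrier = k.sum :=
    (Fintype.card_congr (zigEquiv k)).trans (Fintype.card_fin _)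
  rw [wStar, W_cls, TwoPoset.W_eq_orderSum, hc]
  refine orderSum_congr (zigEquiv k) _ (fun p => ?_) fun f => ⟨fun h p q hpq => ?_, fun h p q hpq => ?_⟩
  · simp only [zigLabel, isBot_zigEquiv]
    simp [XStar]
  · rw [← (zigEquiv k).apply_symm_apply p, ← (zigEquiv k).apply_symm_apply q] at hpq ⊢
    exact h _ _ (Relation.ReflTransGen.single (edge_of_pathRel hk hpq))
  · change Relation.ReflTransGen Zig.Edge p q at hpq
    induction hpq with
    | refl => exact le_rfl
    | tail _ e ih => exact ih.trans (h _ _ (pathRel_of_edge e))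

theorem wStar_eq_zigWord {k : List ℕ} (hk : ∀ a ∈ k, 0 < a) : wStar k = zigWord k := by
  rw [wStar_eq_pathSum hk]
  cases k with
  | nil => exact pathSum_desc [] (by simp) (by simp) (by simp)
  | cons k A =>
    have hk0 := hk k List.mem_cons_self
    rw [zigWord, ← revWord_segment, ← zigSum_eq_linkSum (by simp [segment])
      fun a ha => hk a (List.mem_cons_of_mem _ ha)]
    refine pathSum_congr (by simp [length_segment hk0]) (fun i _ => (zigLabel_cons hk0 A i).symm)
      (fun i _ => ?_) fun i _ => ?_
    · rw [length_segment hk0]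
    · rw [length_segment hk0]

/-! ### Membership of `wStar` in ℌ¹ -/

theorem Zig.bot_le {k : List ℕ} (i : Fin k.length) (n : ℕ) (hn : n < k.get i) :
    (⟨i, ⟨0, by omega⟩⟩ : Zig k) ≤ ⟨i, ⟨n, hn⟩⟩ := by
  induction n with
  | zero => exact le_rfl
  | succ n ih =>
    exact (ih (by omega)).trans (Relation.ReflTransGen.single (Zig.Edge.chain _ _ _ rfl))

/-- The element placed first has nothing below it, so it is the bottom of its segment and carries
the label y. -/
theorem wStar_mem_H1 (k : List ℕ) : wStar k ∈ H1 := by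
  rw [wStar, W_cls, TwoPoset.W]
  refine Subalgebra.sum_mem _ fun f hf => ?_
  simp only [Finset.mem_filter, Finset.mem_univ, true_and] at hf
  revert f
  generalize Fintype.card (XStar k).carrier = n
  intro f hf
  cases n with
  | zero => simp
  | succ n =>
    rw [List.ofFn_succ, List.prod_cons]
    have : (XStar k).label (f.symm 0) = Letter.y := by
      obtain ⟨⟨i, ⟨a, ha⟩⟩, hp⟩ : ∃ p : Zig k, f.symm 0 = p := ⟨_, rfl⟩
      have h0 := hf _ _ (Zig.bot_le i a ha)
      rw [← hp, f.apply_symm_apply, Fin.le_zero_iff] at h0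
      rw [← h0]
      refine (congrArg (XStar k).label (f.symm_apply_apply _)).trans ?_
      simp [XStar]
    rw [this]
    exact ⟨0, _, by rw [map_zero, zero_add]⟩

open Finset.HasAntidiagonal (antidiagonal)

/-! ### Binomial identities -/

/-- The product of binomials is C(n,L)·C(n-L,e), so this is an alternating row sum; `hn` ensures
that stopping at `K` loses nothing. -/
theorem sum_neg_one_pow_choose_mul (K L n : ℕ) (hn : n ≤ K + L) :
    ∑ p ∈ antidiagonal K, (-1) ^ p.1 * ((L + p.1).choose p.1 : ℤ) * (n.choose (L + p.1) : ℤ) =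
      if n = L then 1 else 0 := by
  have h (e : ℕ) : ((L + e).choose e : ℤ) * (n.choose (L + e) : ℤ) =
      n.choose L * ((n - L).choose e : ℤ) := by
    rw [mul_comm]
    have := Nat.choose_mul (n := n) (Nat.le_add_right L e)
    rw [Nat.add_sub_cancel_left, Nat.choose_symm_add] at this
    exact_mod_cast this
  simp_rw [mul_assoc, h, mul_left_comm _ (n.choose L : ℤ), ← Finset.mul_sum]
  rw [Finset.Nat.sum_antidiagonal_eq_sum_range_succ_mk]
  rcases Nat.lt_or_ge n L with hl | hl
  · rw [Nat.choose_eq_zero_of_lt hl, if_neg (by omega)]; simp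
  · have : ∑ i ∈ Finset.range (K + 1), (-1 : ℤ) ^ i * ((n - L).choose i : ℤ) =
        ∑ i ∈ Finset.range (n - L + 1), (-1 : ℤ) ^ i * ((n - L).choose i : ℤ) := by
      symm
      refine Finset.sum_subset (Finset.range_mono (by omega)) fun i _ hi => ?_
      rw [Nat.choose_eq_zero_of_lt (by simpa using hi)]; simp
    rw [this, Int.alternating_sum_range_choose]
    by_cases hnl : n = L
    · simp [hnl]
    · rw [if_neg (by omega), if_neg hnl, mul_zero]

/-- Compare coefficients of z^K in (1+z)^{-(L+1)}(1+z)^n. The exponent n-L-1 equals -(s-K+1), and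
upper negation turns C(-(s-K+1), K) into (-1)^K C(s,K). -/
theorem sum_neg_one_pow_choose_mul_choose (K L s n : ℕ) (hn : s + n = K + L) :
    ∑ p ∈ antidiagonal K, (-1) ^ p.1 * ((L + p.1).choose p.1 : ℤ) * (n.choose p.2 : ℤ) =
      (-1) ^ K * (s.choose K : ℤ) := by
  have h (e : ℕ) : Ring.choose (-((L : ℤ) + 1)) e = (-1) ^ e * ((L + e).choose e : ℤ) := by
    rw [Ring.choose_neg, show (L : ℤ) + 1 + e - 1 = ((L + e : ℕ) : ℤ) by push_cast; ring,
      Ring.choose_natCast]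
    simp [Int.negOnePow_def, Units.smul_def]
  have h2 := Ring.add_choose_eq K (Commute.all (-((L : ℤ) + 1)) (n : ℤ))
  simp_rw [Ring.choose_natCast, h] at h2
  rw [← h2, show -((L : ℤ) + 1) + n = -((s : ℤ) - K + 1) by
      have : (s : ℤ) + n = K + L := by exact_mod_cast hn
      linarith,
    Ring.choose_neg, show (s : ℤ) - K + 1 + K - 1 = (s : ℕ) by ring, Ring.choose_natCast]
  simp [Int.negOnePow_def, Units.smul_def]

/-! ### Shuffles of chains -/

theorem chainWord_succ (n : ℕ) : chainWord (n + 1) = chainWord n * var Letter.x := by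
  rw [chainWord, pow_succ, ← mul_assoc, chainWord]

theorem sum_antidiagonal_succ_chainWord (A B : ℕ → H) (α β n : ℕ) :
    ∑ p ∈ antidiagonal (n + 1),
        (p.2.choose β • A p.1 + p.2.choose α • B p.1) * chainWord p.2 =
      (Nat.choose 0 β • A (n + 1) + Nat.choose 0 α • B (n + 1)) * chainWord 0 +
      (∑ p ∈ antidiagonal n,
        ((p.2 + 1).choose β • A p.1 + (p.2 + 1).choose α • B p.1) * chainWord p.2) *
          var Letter.x := by
  rw [Finset.Nat.antidiagonal_succ', Finset.sum_cons, Finset.sum_map, Finset.sum_mul]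
  simp [chainWord_succ, mul_assoc]

/-- Sort the shuffle by the chain containing the last y and by the number `p.2` of x's after it. If
that y is in the second chain, all β of its x's come after it, in C(p.2, β) possible places, while
the first chain has kept `p.1` x's before it; and symmetrically. -/
theorem sh_chainWord (c d : H) (α β : ℕ) :
    sh (c * chainWord α) (d * chainWord β) = ∑ p ∈ antidiagonal (α + β),
      (p.2.choose β • sh (c * chainWord p.1) d + p.2.choose α • sh c (d * chainWord p.1)) *
        chainWord p.2 := by
  have h0 : chainWord 0 = var Letter.y := by simp [chainWord]
  induction hN : α + β generalizing α β with
  | zero =>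
    obtain ⟨rfl, rfl⟩ : α = 0 ∧ β = 0 := by omega
    simp [h0, sh_mul_var, add_mul, add_comm]
  | succ N ih =>
    rw [sum_antidiagonal_succ_chainWord (fun s => sh (c * chainWord s) d)
      (fun s => sh c (d * chainWord s))]
    cases α with
    | zero =>
      obtain rfl : β = N + 1 := by omega
      rw [chainWord_succ, h0, ← mul_assoc, sh_mul_var, mul_assoc, ← chainWord_succ, ← h0,
        ih 0 N (by omega)]
      congr 1
      · simp
      · congr 1
        refine Finset.sum_congr rfl fun p hp => ?_
        rw [Finset.HasAntidiagonal.mem_antidiagonal] at hp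
        rw [Nat.choose_succ_succ, Nat.choose_eq_zero_of_lt (by omega : p.2 < N.succ), add_zero,
          Nat.choose_zero_right, Nat.choose_zero_right]
    | succ α =>
      cases β with
      | zero =>
        obtain rfl : α = N := by omega
        rw [chainWord_succ, h0, ← mul_assoc, sh_mul_var, mul_assoc, ← chainWord_succ, ← h0,
          ih α 0 (by omega)]
        rw [add_comm]
        congr 1
        · simp
        · congr 1
          refine Finset.sum_congr rfl fun p hp => ?_
          rw [Finset.HasAntidiagonal.mem_antidiagonal] at hp
          rw [Nat.choose_succ_succ, Nat.choose_eq_zero_of_lt (by omega : p.2 < α.succ), add_zero,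
            Nat.choose_zero_right, Nat.choose_zero_right]
      | succ β =>
        rw [chainWord_succ, chainWord_succ, ← mul_assoc, ← mul_assoc, sh_mul_var, mul_assoc,
          ← chainWord_succ, mul_assoc, ← chainWord_succ, ih α (β + 1) (by omega),
          ih (α + 1) β (by omega), ← add_mul, ← Finset.sum_add_distrib]
        simp only [Nat.choose_zero_succ, zero_smul, add_zero, zero_mul, zero_add, ← add_mul]
        congr 1
        refine Finset.sum_congr rfl fun p _ => ?_
        rw [Nat.choose_succ_succ, Nat.choose_succ_succ, add_smul, add_smul]
        congr 1
        abel

/-- After expanding every shuffle by its last y, the two binomial identities evaluate the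
coefficients: the first family survives only for `q.2 = L`, the second gets (-1)^K C(q.1, K). -/
theorem sum_sh_chainWord (c d : H) (K L : ℕ) :
    ∑ p ∈ antidiagonal K, ((-1) ^ p.1 * ((L + p.1).choose p.1 : ℤ)) •
        sh (c * chainWord p.2) (d * chainWord (L + p.1)) =
      sh (c * chainWord K) d * chainWord L +
        (-1 : ℤ) ^ K • ∑ p ∈ antidiagonal L,
          ((K + p.1).choose p.1) • (sh c (d * chainWord (K + p.1)) * chainWord p.2) := by
  have h1 : ∀ p ∈ antidiagonal K, ((-1) ^ p.1 * ((L + p.1).choose p.1 : ℤ)) •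
        sh (c * chainWord p.2) (d * chainWord (L + p.1)) =
      ∑ q ∈ antidiagonal (K + L),
        (((-1) ^ p.1 * ((L + p.1).choose p.1 : ℤ) * (q.2.choose (L + p.1) : ℤ)) •
          (sh (c * chainWord q.1) d * chainWord q.2) +
        ((-1) ^ p.1 * ((L + p.1).choose p.1 : ℤ) * (q.2.choose p.2 : ℤ)) •
          (sh c (d * chainWord q.1) * chainWord q.2)) := by
    intro p hp
    rw [Finset.HasAntidiagonal.mem_antidiagonal] at hp
    rw [sh_chainWord, show p.2 + (L + p.1) = K + L by omega, Finset.smul_sum]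
    refine Finset.sum_congr rfl fun q _ => ?_
    rw [add_mul, smul_add, mul_smul _ (q.2.choose (L + p.1) : ℤ), mul_smul _ (q.2.choose p.2 : ℤ),
      smul_mul_assoc, smul_mul_assoc, natCast_zsmul, natCast_zsmul]
  rw [Finset.sum_congr rfl h1, Finset.sum_comm]
  have h2 : ∀ q ∈ antidiagonal (K + L), (∑ p ∈ antidiagonal K,
      (((-1) ^ p.1 * ((L + p.1).choose p.1 : ℤ) * (q.2.choose (L + p.1) : ℤ)) •
          (sh (c * chainWord q.1) d * chainWord q.2) +
        ((-1) ^ p.1 * ((L + p.1).choose p.1 : ℤ) * (q.2.choose p.2 : ℤ)) •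
          (sh c (d * chainWord q.1) * chainWord q.2))) =
      (if q.2 = L then sh (c * chainWord q.1) d * chainWord q.2 else 0) +
      (-1 : ℤ) ^ K • (q.1.choose K • (sh c (d * chainWord q.1) * chainWord q.2)) := by
    intro q hq
    rw [Finset.HasAntidiagonal.mem_antidiagonal] at hq
    rw [Finset.sum_add_distrib, ← Finset.sum_smul, ← Finset.sum_smul,
      sum_neg_one_pow_choose_mul K L q.2 (by omega), sum_neg_one_pow_choose_mul_choose K L q.1 q.2 hq,
      ite_smul, one_smul, zero_smul, mul_smul, natCast_zsmul]
  rw [Finset.sum_congr rfl h2, Finset.sum_add_distrib, ← Finset.smul_sum]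
  congr 1
  · rw [Finset.sum_eq_single (K, L)]
    · simp
    · intro q hq hne
      rw [Finset.HasAntidiagonal.mem_antidiagonal] at hq
      rw [if_neg]
      rintro h
      exact hne (Prod.ext (by simp only; omega) h)
    · simp
  · congr 1
    -- The factor C(q.1, K) vanishes for q.1 < K, which permits the shift q.1 = K + l.
    rw [Finset.Nat.sum_antidiagonal_eq_sum_range_succ_mk,
      Finset.Nat.sum_antidiagonal_eq_sum_range_succ_mk, show (K + L).succ = K + L.succ from rfl,
      Finset.sum_range_add,
      Finset.sum_eq_zero, zero_add]
    · refine Finset.sum_congr rfl fun l _ => ?_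
      rw [Nat.add_sub_add_left, Nat.choose_symm_add]
    · intro l hl
      rw [Nat.choose_eq_zero_of_lt (by simpa using hl), zero_smul]

/-! ### Expansion of zigzags into shuffles of chains -/

/-- The zigzag of `A`, hung onto the lowest element of a chain, expanded into a signed sum of
shuffles; `f` receives the words below that chain. -/
def zigOp : List ℕ → (H → Sh) →ₗ[Sh] Sh
  | [] => LinearMap.proj 1
  | k :: A => toSh (zigWord (k :: A)) • LinearMap.proj 1 -
      zigOp A ∘ₗ LinearMap.funLeft Sh Sh fun c => c * chainWord (k - 1)

theorem zigOp_nil (f : H → Sh) : zigOp [] f = f 1 := rfl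

theorem zigOp_cons (k : ℕ) (A : List ℕ) (f : H → Sh) :
    zigOp (k :: A) f =
      toSh (zigWord (k :: A)) * f 1 - zigOp A fun c => f (c * chainWord (k - 1)) := rfl

theorem zigOp_sum {ι : Type*} (A : List ℕ) (s : Finset ι) (f : ι → H → Sh) :
    zigOp A (fun c => ∑ i ∈ s, f i c) = ∑ i ∈ s, zigOp A (f i) := by
  rw [← map_sum]
  congr 1
  funext c
  simp

theorem zigOp_zsmul (A : List ℕ) (n : ℤ) (f : H → Sh) :
    zigOp A (fun c => n • f c) = n • zigOp A f :=
  map_zsmul (zigOp A) n f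

theorem zigOp_nsmul (A : List ℕ) (n : ℕ) (f : H → Sh) :
    zigOp A (fun c => n • f c) = n • zigOp A f :=
  map_nsmul (zigOp A) n f

theorem zigOp_add (A : List ℕ) (f g : H → Sh) :
    zigOp A (fun c => f c + g c) = zigOp A f + zigOp A g :=
  map_add (zigOp A) f g

theorem zigOp_sub (A : List ℕ) (f g : H → Sh) :
    zigOp A (fun c => f c - g c) = zigOp A f - zigOp A g :=
  map_sub (zigOp A) f g

theorem zigOp_mul (A : List ℕ) (s : Sh) (f : H → Sh) :
    zigOp A (fun c => s * f c) = s * zigOp A f :=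
  map_smul (zigOp A) s f

/-- Unrolling `linkSum` gives an alternating sum of final zigzags times concatenated chains. In
`zigOp` the function of the chains is left free, so identities between words carry over to zigzags.
-/
theorem toSh_linkSum (A : List ℕ) (c : H) :
    toSh (linkSum A c) = zigOp A fun d => toSh (d * c) := by
  induction A generalizing c with
  | nil => rw [zigOp_nil, one_mul, linkSum]
  | cons k A ih =>
    rw [linkSum, map_sub, ih (chainWord (k - 1) * c), zigOp_cons, toSh_sh, one_mul, mul_comm]
    simp only [mul_assoc]
    rfl

/-- The element `w⋆(n + 1, A)` of the shuffle algebra. -/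
def headZig (n : ℕ) (A : List ℕ) : Sh := toSh (zigWord ((n + 1) :: A))

theorem headZig_eq (n : ℕ) (A : List ℕ) :
    headZig n A = zigOp A fun d => toSh (d * chainWord n) := toSh_linkSum A _

/-- The sum of the words of the poset obtained from the chain `y x^m` by hanging the zigzags of
`A` and of `B` onto its lowest element. -/
def forkZig (m : ℕ) (A B : List ℕ) : Sh :=
  zigOp A fun c => zigOp B fun d => toSh (sh c d * chainWord m)

theorem forkZig_nil_right (m : ℕ) (A : List ℕ) : forkZig m A [] = headZig m A := by
  simp only [forkZig, zigOp_nil, sh_one_right, headZig_eq]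

theorem forkZig_nil_left (m : ℕ) (B : List ℕ) : forkZig m [] B = headZig m B := by
  simp only [forkZig, zigOp_nil, sh_one_left, headZig_eq]

theorem headZig_mul_headZig (n m : ℕ) (A B : List ℕ) :
    headZig n A * headZig m B =
      zigOp A fun c => zigOp B fun d => toSh (sh (c * chainWord n) (d * chainWord m)) := by
  simp only [toSh_sh, zigOp_mul, ← headZig_eq]
  rw [mul_comm, headZig_eq n, ← zigOp_mul]
  simp only [mul_comm]

theorem forkZig_cons_left (m n : ℕ) (A B : List ℕ) :
    forkZig m ((n + 1) :: A) B = headZig n A * headZig m B -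
      zigOp A fun c => zigOp B fun d => toSh (sh (c * chainWord n) d * chainWord m) := by
  rw [forkZig, zigOp_cons]
  simp only [sh_one_left, ← headZig_eq]
  rfl

theorem forkZig_cons_right (m n : ℕ) (A B : List ℕ) :
    forkZig m A ((n + 1) :: B) = headZig m A * headZig n B -
      zigOp A fun c => zigOp B fun d => toSh (sh c (d * chainWord n) * chainWord m) := by
  simp only [forkZig, zigOp_cons, zigOp_sub, zigOp_mul, sh_one_right, ← headZig_eq]
  rw [mul_comm]
  rfl

/-- Apply `zigOp A` and `zigOp B` to `sum_sh_chainWord` in the free words `c`, `d`: its right-hand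
terms are exactly the corrections in `forkZig_cons_left` and `forkZig_cons_right`. -/
theorem sum_headZig_mul_headZig (K L : ℕ) (A B : List ℕ) :
    ∑ p ∈ antidiagonal K, ((-1) ^ p.1 * ((L + p.1).choose p.1 : ℤ)) •
        (headZig p.2 A * headZig (L + p.1) B) =
      (headZig K A * headZig L B - forkZig L ((K + 1) :: A) B) +
        (-1 : ℤ) ^ K • ∑ p ∈ antidiagonal L, ((K + p.1).choose p.1) •
          (headZig p.2 A * headZig (K + p.1) B - forkZig p.2 A ((K + p.1 + 1) :: B)) := by
  simp only [forkZig_cons_left, forkZig_cons_right, sub_sub_cancel, headZig_mul_headZig,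
    ← zigOp_zsmul, ← zigOp_nsmul, ← zigOp_sum, ← zigOp_add]
  congr 1
  funext c
  congr 1
  funext d
  simpa only [map_sum, map_add, map_zsmul, map_nsmul] using
    congrArg toSh (sum_sh_chainWord c d K L)

/-! ### Sums over antidiagonals -/

/-- Up to sign this is Vandermonde for (1+z)^{-a}(1+z)^{-b}. Truncated subtraction does no harm: for
`a = 0` the coefficient is 1 at 0 and 0 afterwards. -/
theorem sum_choose_mul_choose (a b n : ℕ) :
    ∑ p ∈ antidiagonal n, (a + p.1 - 1).choose p.1 * (b + p.2 - 1).choose p.2 =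
      (a + b + n - 1).choose n := by
  have h (a e : ℕ) : Ring.choose (-(a : ℤ)) e = (-1) ^ e * ((a + e - 1).choose e : ℤ) := by
    rcases e.eq_zero_or_pos with rfl | he
    · simp
    · rw [Ring.choose_neg, show (a : ℤ) + e - 1 = (a + e - 1 : ℕ) by omega, Ring.choose_natCast]
      simp [Int.negOnePow_def, Units.smul_def]
  have h2 := Ring.add_choose_eq n (Commute.all (-(a : ℤ)) (-(b : ℤ)))
  rw [show -(a : ℤ) + -(b : ℤ) = -((a + b : ℕ) : ℤ) by push_cast; ring] at h2
  simp_rw [h] at h2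
  have h3 : ∑ p ∈ antidiagonal n, (-1) ^ p.1 * ((a + p.1 - 1).choose p.1 : ℤ) *
      ((-1) ^ p.2 * ((b + p.2 - 1).choose p.2 : ℤ)) = (-1) ^ n * ∑ p ∈ antidiagonal n,
        ((a + p.1 - 1).choose p.1 : ℤ) * ((b + p.2 - 1).choose p.2 : ℤ) := by
    rw [Finset.mul_sum]
    refine Finset.sum_congr rfl fun p hp => ?_
    rw [Finset.HasAntidiagonal.mem_antidiagonal] at hp
    rw [← hp, pow_add]
    ring
  rw [h3] at h2
  have := mul_left_cancel₀ (pow_ne_zero n (by norm_num)) h2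
  exact_mod_cast this.symm

theorem sum_antidiagonal_left_comm {M : Type*} [AddCommMonoid M] (n : ℕ) (f : ℕ → ℕ → ℕ → M) :
    ∑ p ∈ antidiagonal n, ∑ q ∈ antidiagonal p.2, f p.1 q.1 q.2 =
      ∑ p ∈ antidiagonal n, ∑ q ∈ antidiagonal p.2, f q.1 p.1 q.2 := by
  rw [Finset.sum_sigma', Finset.sum_sigma']
  refine Finset.sum_bij' (fun x _ => ⟨(x.2.1, x.1.1 + x.2.2), (x.1.1, x.2.2)⟩)
    (fun x _ => ⟨(x.2.1, x.1.1 + x.2.2), (x.1.1, x.2.2)⟩) ?_ ?_ ?_ ?_ ?_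
  all_goals
    rintro ⟨⟨a, b⟩, ⟨c, d⟩⟩ h
    simp only [Finset.mem_sigma, Finset.HasAntidiagonal.mem_antidiagonal] at h
    obtain ⟨h, h'⟩ := h
  · simp only [Finset.mem_sigma, Finset.HasAntidiagonal.mem_antidiagonal]
    exact ⟨by omega, trivial⟩
  · simp only [Finset.mem_sigma, Finset.HasAntidiagonal.mem_antidiagonal]
    exact ⟨by omega, trivial⟩
  · subst h'; rfl
  · subst h'; rfl
  · rfl

theorem sum_antidiagonal_assoc {M : Type*} [AddCommMonoid M] (n : ℕ) (f : ℕ → ℕ → ℕ → M) :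
    ∑ p ∈ antidiagonal n, ∑ q ∈ antidiagonal p.2, f p.1 q.1 q.2 =
      ∑ p ∈ antidiagonal n, ∑ q ∈ antidiagonal p.1, f q.1 q.2 p.2 := by
  rw [Finset.sum_sigma', Finset.sum_sigma']
  refine Finset.sum_bij' (fun x _ => ⟨(x.1.1 + x.2.1, x.2.2), (x.1.1, x.2.1)⟩)
    (fun x _ => ⟨(x.2.1, x.2.2 + x.1.2), (x.2.2, x.1.2)⟩) ?_ ?_ ?_ ?_ ?_
  all_goals
    rintro ⟨⟨a, b⟩, ⟨c, d⟩⟩ h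
    simp only [Finset.mem_sigma, Finset.HasAntidiagonal.mem_antidiagonal] at h
    obtain ⟨h, h'⟩ := h
  · simp only [Finset.mem_sigma, Finset.HasAntidiagonal.mem_antidiagonal]
    exact ⟨by omega, trivial⟩
  · simp only [Finset.mem_sigma, Finset.HasAntidiagonal.mem_antidiagonal]
    exact ⟨by omega, trivial⟩
  · subst h'; rfl
  · subst h'; rfl
  · rfl

theorem sum_antidiagonal_add {M : Type*} [AddCommMonoid M] (i j L : ℕ) (f : ℕ → ℕ → M)
    (hf : ∀ a b, a < i ∨ b < j → f a b = 0) :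
    ∑ p ∈ antidiagonal (i + j + L), f p.1 p.2 =
      ∑ p ∈ antidiagonal L, f (i + p.1) (j + p.2) := by
  symm
  refine Finset.sum_bij_ne_zero (fun p _ _ => (i + p.1, j + p.2)) ?_ ?_ ?_ ?_
  · intro p hp _
    rw [Finset.HasAntidiagonal.mem_antidiagonal] at hp ⊢
    simp only
    omega
  · intro p _ _ q _ _ h
    simp only [Prod.mk.injEq, add_right_inj] at h
    exact Prod.ext h.1 h.2
  · intro p hp h
    rw [Finset.HasAntidiagonal.mem_antidiagonal] at hp
    have hle : ¬ (p.1 < i ∨ p.2 < j) := fun h' => h (hf _ _ h')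
    refine ⟨(p.1 - i, p.2 - j), ?_, ?_, ?_⟩
    · rw [Finset.HasAntidiagonal.mem_antidiagonal]; simp only; omega
    · simp only
      rwa [show i + (p.1 - i) = p.1 by omega, show j + (p.2 - j) = p.2 by omega]
    · ext <;> simp only <;> omega
  · intros; rfl

/-- For fixed total exponents (a, b), the coefficient is the Vandermonde sum of C(a, p.1)·C(b, p.2)
over p.1 + p.2 = K. -/
theorem sum_choose_mul_choose_smul {M : Type*} [AddCommMonoid M] (K L : ℕ) (v : ℕ → ℕ → M) :
    ∑ p ∈ antidiagonal K, ∑ q ∈ antidiagonal L,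
        ((p.1 + q.1).choose q.1 * (p.2 + q.2).choose q.2) • v (p.1 + q.1) (p.2 + q.2) =
      (K + L).choose L • ∑ q ∈ antidiagonal (K + L), v q.1 q.2 := by
  have h : ∀ p ∈ antidiagonal K, ∑ q ∈ antidiagonal L,
        ((p.1 + q.1).choose q.1 * (p.2 + q.2).choose q.2) • v (p.1 + q.1) (p.2 + q.2) =
      ∑ q ∈ antidiagonal (K + L), (q.1.choose p.1 * q.2.choose p.2) • v q.1 q.2 := by
    intro p hp
    rw [Finset.HasAntidiagonal.mem_antidiagonal] at hp
    rw [← hp, sum_antidiagonal_add p.1 p.2 L fun a b => (a.choose p.1 * b.choose p.2) • v a b]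
    · exact Finset.sum_congr rfl fun q _ => by rw [Nat.choose_symm_add, Nat.choose_symm_add]
    · rintro a b (h | h)
      · rw [Nat.choose_eq_zero_of_lt h]; simp
      · rw [Nat.choose_eq_zero_of_lt h]; simp
  rw [Finset.sum_congr rfl h, Finset.sum_comm, Finset.smul_sum]
  refine Finset.sum_congr rfl fun q hq => ?_
  rw [Finset.HasAntidiagonal.mem_antidiagonal] at hq
  rw [← Finset.sum_smul, ← Nat.add_choose_eq, hq, Nat.choose_symm_add]

/-! ### Formal sums of power series -/

open PowerSeries (C coeff)

/-- The sum `∑_{j ≥ 0} F_j t^j`. -/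
def seriesSum : (ℕ → PowerSeries Sh) →ₗ[Sh] PowerSeries Sh where
  toFun F := PowerSeries.mk fun n => ∑ p ∈ antidiagonal n, coeff p.2 (F p.1)
  map_add' F G := by
    ext n
    simp [Finset.sum_add_distrib]
  map_smul' s F := by
    ext n
    simp [Finset.mul_sum]

theorem coeff_seriesSum (n : ℕ) (F : ℕ → PowerSeries Sh) :
    coeff n (seriesSum F) = ∑ p ∈ antidiagonal n, coeff p.2 (F p.1) := by
  simp [seriesSum]

theorem seriesSum_smul (s : Sh) (F : ℕ → PowerSeries Sh) :
    seriesSum (fun j => s • F j) = s • seriesSum F :=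
  map_smul seriesSum s F

theorem seriesSum_nsmul (s : ℕ) (F : ℕ → PowerSeries Sh) :
    seriesSum (fun j => s • F j) = s • seriesSum F :=
  map_nsmul seriesSum s F

theorem coeff_seriesSum_C (n : ℕ) (f : ℕ → Sh) :
    coeff n (seriesSum fun j => C (f j)) = f n := by
  rw [coeff_seriesSum, Finset.sum_eq_single (n, 0)]
  · simp
  · intro p hp hne
    rw [Finset.HasAntidiagonal.mem_antidiagonal] at hp
    rw [PowerSeries.coeff_C, if_neg]
    rintro h
    exact hne (Prod.ext (by simp only; omega) h)
  · simp

theorem seriesSum_comm (F : ℕ → ℕ → PowerSeries Sh) :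
    (seriesSum fun i => seriesSum fun j => F i j) = seriesSum fun j => seriesSum fun i => F i j := by
  ext n
  simp only [coeff_seriesSum]
  exact sum_antidiagonal_left_comm n fun i j u => coeff u (F i j)

theorem seriesSum_seriesSum (F : ℕ → ℕ → PowerSeries Sh) :
    (seriesSum fun i => seriesSum fun j => F i j) =
      seriesSum fun n => ∑ p ∈ antidiagonal n, F p.1 p.2 := by
  ext n
  simp only [coeff_seriesSum, map_sum]
  exact sum_antidiagonal_assoc n fun i j u => coeff u (F i j)

/-- The sum `∑_{l_1, …, l_r ≥ 0} ∏_j binom(b_j + l_j - 1, l_j) Φ(b_r + l_r, …, b_1 + l_1)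
t^{l_1 + ⋯ + l_r}` for a function `Φ` with values in power series. -/
def hatOp : List ℕ → (List ℕ → PowerSeries Sh) →ₗ[Sh] PowerSeries Sh
  | [] => LinearMap.proj []
  | b :: B => seriesSum ∘ₗ LinearMap.pi fun l => (b + l - 1).choose l •
      (hatOp B ∘ₗ LinearMap.funLeft Sh (PowerSeries Sh) fun M => M ++ [b + l])

theorem hatOp_nil (Φ : List ℕ → PowerSeries Sh) : hatOp [] Φ = Φ [] := rfl

theorem hatOp_cons (b : ℕ) (B : List ℕ) (Φ : List ℕ → PowerSeries Sh) :
    hatOp (b :: B) Φ = seriesSum fun l =>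
      (b + l - 1).choose l • hatOp B fun M => Φ (M ++ [b + l]) := rfl

theorem hatOp_smul (B : List ℕ) (s : Sh) (Φ : List ℕ → PowerSeries Sh) :
    hatOp B (fun M => s • Φ M) = s • hatOp B Φ :=
  map_smul (hatOp B) s Φ

theorem hatOp_nsmul (B : List ℕ) (s : ℕ) (Φ : List ℕ → PowerSeries Sh) :
    hatOp B (fun M => s • Φ M) = s • hatOp B Φ :=
  map_nsmul (hatOp B) s Φ

theorem hatOp_sub (B : List ℕ) (Φ Ψ : List ℕ → PowerSeries Sh) :
    hatOp B (fun M => Φ M - Ψ M) = hatOp B Φ - hatOp B Ψ :=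
  map_sub (hatOp B) Φ Ψ

theorem hatOp_sum {ι : Type*} (B : List ℕ) (s : Finset ι) (Φ : ι → List ℕ → PowerSeries Sh) :
    hatOp B (fun M => ∑ i ∈ s, Φ i M) = ∑ i ∈ s, hatOp B (Φ i) := by
  rw [← map_sum]
  congr 1
  funext M
  simp

theorem hatOp_seriesSum (B : List ℕ) (Φ : List ℕ → ℕ → PowerSeries Sh) :
    hatOp B (fun M => seriesSum (Φ M)) = seriesSum fun j => hatOp B fun M => Φ M j := by
  induction B generalizing Φ with
  | nil => rfl
  | cons b B ih =>
    simp only [hatOp_cons, ih, ← seriesSum_nsmul]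
    exact seriesSum_comm _

theorem hatOp_append (A B : List ℕ) (Φ : List ℕ → PowerSeries Sh) :
    hatOp (A ++ B) Φ = hatOp A fun M => hatOp B fun N => Φ (N ++ M) := by
  induction A generalizing Φ with
  | nil => simp only [List.nil_append, hatOp_nil, List.append_nil]
  | cons a A ih => simp only [List.cons_append, hatOp_cons, ih, List.append_assoc]

theorem hatOp_comm (A B : List ℕ) (Φ : List ℕ → List ℕ → PowerSeries Sh) :
    (hatOp A fun M => hatOp B fun N => Φ M N) = hatOp B fun N => hatOp A fun M => Φ M N := by
  induction A generalizing Φ with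
  | nil => rfl
  | cons a A ih =>
    simp only [hatOp_cons, ih, hatOp_seriesSum, hatOp_nsmul]

theorem hatOp_snoc (B : List ℕ) (b : ℕ) (Φ : List ℕ → PowerSeries Sh) :
    hatOp (B ++ [b]) Φ =
      hatOp B fun M => seriesSum fun l => (b + l - 1).choose l • Φ ((b + l) :: M) := by
  rw [hatOp_append]
  rfl

theorem hatOp_congr {B : List ℕ} (hB : ∀ b ∈ B, 0 < b) {Φ Ψ : List ℕ → PowerSeries Sh}
    (h : ∀ M : List ℕ, (∀ m ∈ M, 0 < m) → M.length = B.length → Φ M = Ψ M) :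
    hatOp B Φ = hatOp B Ψ := by
  induction B generalizing Φ Ψ with
  | nil => exact h [] (by simp) rfl
  | cons b B ih =>
    rw [hatOp_cons, hatOp_cons]
    congr 1
    funext l
    congr 1
    refine ih (fun a ha => hB a (List.mem_cons_of_mem _ ha)) fun M hM hl => h _ ?_ (by simp [hl])
    have := hB b List.mem_cons_self
    intro m hm
    rcases List.mem_append.1 hm with hm | hm
    · exact hM m hm
    · rw [List.mem_singleton.1 hm]; omega

theorem hatOp_congr_length {B : List ℕ} {Φ Ψ : List ℕ → PowerSeries Sh}
    (h : ∀ M : List ℕ, M.length = B.length → Φ M = Ψ M) : hatOp B Φ = hatOp B Ψ := by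
  induction B generalizing Φ Ψ with
  | nil => exact h [] rfl
  | cons b B ih =>
    rw [hatOp_cons, hatOp_cons]
    congr 1
    funext l
    congr 1
    exact ih fun M hl => h _ (by simp [hl])

/-- When only the total weight counts, the binomial weights convolve to a single one by
`sum_choose_mul_choose`. -/
theorem hatOp_comp_sum (B : List ℕ) (F : ℕ → PowerSeries Sh) :
    hatOp B (fun M => F M.sum) = seriesSum fun n => (B.sum + n - 1).choose n • F (B.sum + n) := by
  induction B generalizing F with
  | nil =>
    ext n
    rw [hatOp_nil, coeff_seriesSum, Finset.sum_eq_single (0, n)]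
    · simp
    · intro p hp hne
      rw [Finset.HasAntidiagonal.mem_antidiagonal] at hp
      have : p.1 ≠ 0 := fun h => hne (Prod.ext h (by simp only; omega))
      rw [Nat.choose_eq_zero_of_lt (by simp; omega)]
      simp
    · simp
  | cons b B ih =>
    rw [hatOp_cons]
    have h (l : ℕ) : hatOp B (fun M => F (M ++ [b + l]).sum) = seriesSum fun n =>
        (B.sum + n - 1).choose n • F (B.sum + n + (b + l)) := by
      simpa using ih fun n => F (n + (b + l))
    simp only [h, List.sum_cons, ← seriesSum_nsmul]
    rw [seriesSum_seriesSum]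
    congr 1
    funext n
    rw [← sum_choose_mul_choose, Finset.sum_smul]
    refine Finset.sum_congr rfl fun p hp => ?_
    rw [Finset.HasAntidiagonal.mem_antidiagonal] at hp
    rw [mul_smul]
    congr 3
    omega

theorem sum_antidiagonalTuple_succ {M : Type*} [AddCommMonoid M] (r n : ℕ)
    (f : (Fin (r + 1) → ℕ) → M) :
    ∑ l ∈ Finset.Nat.antidiagonalTuple (r + 1) n, f l =
      ∑ p ∈ antidiagonal n, ∑ l ∈ Finset.Nat.antidiagonalTuple r p.2, f (Fin.cons p.1 l) := by
  rw [Finset.sum_sigma']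
  refine Finset.sum_bij' (fun l _ => ⟨(l 0, ∑ i, Fin.tail l i), Fin.tail l⟩)
    (fun x _ => Fin.cons x.1.1 x.2) ?_ ?_ ?_ ?_ ?_
  · intro l hl
    rw [Finset.Nat.mem_antidiagonalTuple, Fin.sum_univ_succ] at hl
    simp only [Finset.mem_sigma, Finset.HasAntidiagonal.mem_antidiagonal,
      Finset.Nat.mem_antidiagonalTuple]
    exact ⟨hl, trivial⟩
  · rintro ⟨⟨a, b⟩, l⟩ h
    simp only [Finset.mem_sigma, Finset.HasAntidiagonal.mem_antidiagonal,
      Finset.Nat.mem_antidiagonalTuple] at h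
    rw [Finset.Nat.mem_antidiagonalTuple, Fin.sum_univ_succ]
    simp only [Fin.cons_zero, Fin.cons_succ]
    rw [h.2, h.1]
  · intro l _
    exact Fin.cons_self_tail l
  · rintro ⟨⟨a, b⟩, l⟩ h
    simp only [Finset.mem_sigma, Finset.HasAntidiagonal.mem_antidiagonal,
      Finset.Nat.mem_antidiagonalTuple] at h
    simp only [Fin.cons_zero, Fin.tail_cons, h.2]
  · intro l _
    rw [Fin.cons_self_tail]

theorem revSeries_eq_hatOp (Φ : List ℕ → Sh) (k : List ℕ) :
    revSeries Φ k = hatOp k fun M => C (Φ M) := by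
  ext n
  induction k generalizing Φ n with
  | nil =>
    rw [revSeries, PowerSeries.coeff_mk, hatOp_nil, PowerSeries.coeff_C]
    cases n <;> simp
  | cons b B ih =>
    rw [hatOp_cons, coeff_seriesSum, revSeries, PowerSeries.coeff_mk]
    refine (sum_antidiagonalTuple_succ _ _ _).trans (Finset.sum_congr rfl fun p _ => ?_)
    rw [map_nsmul, ← ih (fun M => Φ (M ++ [b + p.1])), revSeries, PowerSeries.coeff_mk,
      Finset.smul_sum]
    refine Finset.sum_congr rfl fun l _ => ?_
    have h1 : (∏ j : Fin (B.length + 1), ((b :: B).get j + (Fin.cons p.1 l : _ → ℕ) j - 1).choose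
        ((Fin.cons p.1 l : _ → ℕ) j)) = (b + p.1 - 1).choose p.1 *
          ∏ j, (B.get j + l j - 1).choose (l j) := Fin.prod_univ_succ _
    have h2 : (List.ofFn fun j : Fin (B.length + 1) => (b :: B).get j + (Fin.cons p.1 l : _ → ℕ) j) =
        (b + p.1) :: List.ofFn fun j => B.get j + l j := List.ofFn_succ
    refine (congrArg₂ (fun (a : ℕ) (L : List ℕ) => a • Φ L.reverse) h1 h2).trans ?_
    rw [mul_smul, List.reverse_cons]

/-! ### The two local identities -/

/-- The element `w⋆(k)` of the shuffle algebra. -/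
def starSh (k : List ℕ) : Sh := toSh (zigWord k)

/-- The reversed `t`-adic series of `w⋆`. -/
def revHat (B : List ℕ) : PowerSeries Sh := hatOp B fun M => C (starSh M)

/-- The `t`-adic series attached to a fork with branches `A` and the reversal of `B`. -/
def forkHat (A B : List ℕ) : PowerSeries Sh :=
  hatOp B fun M => seriesSum fun m => C (forkZig m A M)

theorem nsmul_C (n : ℕ) (s : Sh) : n • C s = C (n • s) := (map_nsmul C n s).symm

theorem smul_C (r s : Sh) : r • (C s : PowerSeries Sh) = C (r * s) := by
  rw [PowerSeries.smul_eq_C_mul, map_mul]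

theorem sum_C {ι : Type*} (t : Finset ι) (s : ι → Sh) : ∑ i ∈ t, C (s i) = C (∑ i ∈ t, s i) :=
  (map_sum C s t).symm

theorem revHat_snoc (B : List ℕ) (b : ℕ) : revHat (B ++ [b]) =
    hatOp B fun M => seriesSum fun l => C ((b + l - 1).choose l • starSh ((b + l) :: M)) := by
  simp only [revHat, hatOp_snoc, nsmul_C]

theorem revHat_cons_snoc (a : ℕ) (B : List ℕ) (b : ℕ) : revHat (a :: (B ++ [b])) =
    hatOp B fun M => seriesSum fun n => C (∑ p ∈ antidiagonal n,
      ((a + p.1 - 1).choose p.1 * (b + p.2 - 1).choose p.2) •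
        starSh ((b + p.2) :: (M ++ [a + p.1]))) := by
  simp only [revHat, hatOp_cons, hatOp_snoc, ← hatOp_nsmul, ← hatOp_seriesSum, ← seriesSum_nsmul,
    seriesSum_seriesSum, nsmul_C, sum_C, mul_smul, List.cons_append]

theorem sum_neg_one_pow_mul_choose (n : ℕ) :
    ∑ p ∈ antidiagonal n, (-1 : Sh) ^ p.1 * ((p.1 + p.2).choose p.2 : Sh) =
      if n = 0 then 1 else 0 := by
  have h := (Commute.all (-1 : Sh) 1).add_pow' n
  rw [neg_add_cancel] at h
  rw [← zero_pow_eq, h]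
  refine Finset.sum_congr rfl fun p hp => ?_
  rw [Finset.HasAntidiagonal.mem_antidiagonal] at hp
  rw [one_pow, mul_one, nsmul_eq_mul, mul_comm, ← hp, Nat.choose_symm_add]

theorem sum_neg_one_pow_choose_smul (K L : ℕ) (v : ℕ → ℕ → Sh) :
    ∑ p ∈ antidiagonal L, (-1 : Sh) ^ p.1 * ∑ q ∈ antidiagonal p.2,
        ((p.1 + q.1).choose q.1 * (K + q.2).choose q.2) • v (K + q.2) (p.1 + q.1) =
      (K + L).choose L • v (K + L) 0 := by
  simp_rw [Finset.mul_sum]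
  rw [sum_antidiagonal_assoc L fun j l m => (-1 : Sh) ^ j *
    ((j + l).choose l * (K + m).choose m) • v (K + m) (j + l)]
  have h : ∀ p ∈ antidiagonal L, ∑ q ∈ antidiagonal p.1, (-1 : Sh) ^ q.1 *
      ((q.1 + q.2).choose q.2 * (K + p.2).choose p.2) • v (K + p.2) (q.1 + q.2) =
      (if p.1 = 0 then 1 else 0) * ((K + p.2).choose p.2 • v (K + p.2) p.1) := by
    intro p _
    rw [← sum_neg_one_pow_mul_choose, Finset.sum_mul]
    refine Finset.sum_congr rfl fun q hq => ?_
    rw [Finset.HasAntidiagonal.mem_antidiagonal] at hq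
    rw [hq]
    simp only [nsmul_eq_mul, Nat.cast_mul]
    ring
  rw [Finset.sum_congr rfl h, Finset.sum_eq_single (0, L)]
  · simp
  · intro p hp hne
    rw [Finset.HasAntidiagonal.mem_antidiagonal] at hp
    rw [if_neg, zero_mul]
    exact fun h => hne (Prod.ext h (by simp only; omega))
  · simp

/-- Vandermonde over all `j ≤ K` yields every `u a b` of the given total with the same coefficient.
The `j = K` term is the last sum on the right; the extreme term `u (K + L + 1) 1` is the alternating
sum on the left, where all but one coefficient cancel. -/
theorem rev_identity (K L : ℕ) (u : ℕ → ℕ → Sh) :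
    ∑ j ∈ Finset.range K, ∑ p ∈ antidiagonal L,
        ((j + 1 + p.1 - 1).choose p.1 * (K + 1 - j + p.2 - 1).choose p.2) •
          u (K + 1 - j + p.2) (j + 1 + p.1) -
      ∑ p ∈ antidiagonal L, (-1 : Sh) ^ p.1 * ∑ q ∈ antidiagonal p.2,
        ((p.1 + 1 + q.1 - 1).choose q.1 * (K + 1 + q.2 - 1).choose q.2) •
          u (K + 1 + q.2) (p.1 + 1 + q.1) =
    (K + 1 + L - 1).choose L • ∑ j ∈ Finset.range (K + 1 + L - 1), u (j + 1) (K + 1 + L - j) -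
      ∑ p ∈ antidiagonal L, (K + 1 + p.1 - 1).choose p.1 • u (p.2 + 1) (K + 1 + p.1) := by
  have h1 := sum_choose_mul_choose_smul K L fun a b => u (b + 1) (a + 1)
  have h2 := sum_neg_one_pow_choose_smul K L fun a b => u (a + 1) (b + 1)
  rw [Finset.Nat.sum_antidiagonal_eq_sum_range_succ_mk _ K, Finset.sum_range_succ _ K,
    ← Finset.Nat.sum_antidiagonal_swap (n := K + L),
    Finset.Nat.sum_antidiagonal_eq_sum_range_succ_mk _ (K + L), Finset.sum_range_succ _ (K + L),
    smul_add] at h1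
  simp only [Prod.fst_swap, Prod.snd_swap, Nat.sub_self, zero_add, Nat.choose_self, mul_one] at h1 h2
  have e1 (n m : ℕ) : n + 1 + m = n + m + 1 := by omega
  simp only [e1, Nat.add_sub_cancel]
  rw [h2, sub_eq_sub_iff_add_eq_add]
  refine Eq.trans (congrArg₂ _ ?_ ?_) (h1.trans (congrArg₂ _ (congrArg _ ?_) rfl))
  · refine Finset.sum_congr rfl fun j hj => Finset.sum_congr rfl fun p _ => ?_
    have := Finset.mem_range.1 hj
    rw [show K + 1 - j + p.2 = K - j + p.2 + 1 by omega, Nat.add_sub_cancel]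
  · rfl
  · refine Finset.sum_congr rfl fun j hj => ?_
    have := Finset.mem_range.1 hj
    rw [show K + L + 1 - j = K + L - j + 1 by omega]

/-- The middle entries are inert: for each fixed `M`, only the two end entries vary. -/
theorem revHat_identity (K : ℕ) (B : List ℕ) :
    ∑ j ∈ Finset.range K, revHat ((j + 1) :: (B ++ [K + 1 - j])) -
        seriesSum (fun j => (-1 : Sh) ^ j • revHat ((j + 1) :: (B ++ [K + 1]))) =
      hatOp B (fun M => seriesSum fun l => (K + 1 + l - 1).choose l •
        C (∑ j ∈ Finset.range (K + 1 + l - 1), starSh ((j + 1) :: (M ++ [K + 1 + l - j])))) -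
      hatOp ((K + 1) :: B) fun M => seriesSum fun m => C (headZig m M) := by
  rw [hatOp_cons]
  simp only [revHat_cons_snoc, ← hatOp_sum, ← hatOp_smul, ← hatOp_nsmul, ← hatOp_seriesSum,
    ← hatOp_sub]
  congr 1
  funext M
  simp only [← seriesSum_smul, ← seriesSum_nsmul, smul_C, nsmul_C, seriesSum_seriesSum, sum_C]
  ext L
  rw [map_sub, map_sub, map_sum]
  simp only [coeff_seriesSum_C]
  exact rev_identity K L fun a b => starSh (a :: (M ++ [b]))

/-- For fixed `M`, the coefficient of t^L is `sum_headZig_mul_headZig`. Its `j = K` summand cancels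
against the product of the two heads on the right, leaving `j < K`. -/
theorem mid_identity (K : ℕ) (A B : List ℕ) :
    ∑ j ∈ Finset.range K, ((-1) ^ (K + 1 - j) * headZig j A) • revHat (B ++ [K + 1 - j]) -
        seriesSum (fun j => ((-1) ^ (K + 1) * headZig j A) • revHat (B ++ [K + 1])) =
      forkHat ((K + 1) :: A) B - (-1 : Sh) ^ (K + 1) • forkHat A (B ++ [K + 1]) := by
  simp only [revHat_snoc, forkHat, hatOp_snoc, ← hatOp_sum, ← hatOp_smul,
    ← hatOp_seriesSum, ← hatOp_sub]
  congr 1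
  funext M
  simp only [← seriesSum_smul, ← seriesSum_nsmul, smul_C, nsmul_C, seriesSum_seriesSum, sum_C]
  ext L
  rw [map_sub, map_sub, map_sum]
  simp only [coeff_seriesSum_C]
  have h := sum_headZig_mul_headZig K L A M
  rw [← Finset.Nat.sum_antidiagonal_swap, Finset.Nat.sum_antidiagonal_eq_sum_range_succ_mk,
    Finset.sum_range_succ] at h
  simp only [Prod.fst_swap, Prod.snd_swap, Nat.sub_self, add_zero, Nat.choose_zero_right, pow_zero,
    Nat.cast_one, mul_one, one_smul, smul_sub, Finset.sum_sub_distrib, Finset.smul_sum] at h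
  have e1 (n m : ℕ) : n + 1 + m = n + m + 1 := by omega
  simp only [e1, Nat.add_sub_cancel]
  have h1 : ∑ j ∈ Finset.range K, (-1) ^ (K + 1 - j) * headZig j A *
        (K + 1 - j + L - 1).choose L • starSh ((K + 1 - j + L) :: M) =
      - ∑ j ∈ Finset.range K, ((-1) ^ (K - j) * ((L + (K - j)).choose (K - j) : ℤ)) •
        (headZig j A * headZig (L + (K - j)) M) := by
    rw [← Finset.sum_neg_distrib]
    refine Finset.sum_congr rfl fun j hj => ?_
    have := Finset.mem_range.1 hj
    rw [show K + 1 - j + L = L + (K - j) + 1 by omega, Nat.add_sub_cancel,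
      show K + 1 - j = K - j + 1 by omega, Nat.choose_symm_add]
    simp only [headZig, starSh, zsmul_eq_mul, nsmul_eq_mul]
    push_cast
    ring
  have h2 : ∑ p ∈ antidiagonal L, (-1) ^ (K + 1) * headZig p.1 A *
        (K + p.2).choose p.2 • starSh ((K + p.2 + 1) :: M) =
      - ∑ p ∈ antidiagonal L, (-1 : ℤ) ^ K • (K + p.1).choose p.1 •
        (headZig p.2 A * headZig (K + p.1) M) := by
    rw [← Finset.Nat.sum_antidiagonal_swap, ← Finset.sum_neg_distrib]
    refine Finset.sum_congr rfl fun p _ => ?_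
    simp only [headZig, starSh, zsmul_eq_mul, nsmul_eq_mul, Prod.fst_swap, Prod.snd_swap]
    push_cast
    ring
  have h3 : (-1) ^ (K + 1) * ∑ p ∈ antidiagonal L,
        (K + p.1).choose p.1 • forkZig p.2 A ((K + p.1 + 1) :: M) =
      - ∑ p ∈ antidiagonal L, (-1 : ℤ) ^ K • (K + p.1).choose p.1 •
        forkZig p.2 A ((K + p.1 + 1) :: M) := by
    rw [Finset.mul_sum, ← Finset.sum_neg_distrib]
    refine Finset.sum_congr rfl fun p _ => ?_
    simp only [zsmul_eq_mul, nsmul_eq_mul]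
    push_cast
    ring
  rw [h1, h2, h3]
  linear_combination -h

/-! ### The cyclic sum -/

/-- The `t`-adic series of `w⋆_Ŝ(k)` in the shuffle algebra. -/
def starHat (k : List ℕ) : PowerSeries Sh :=
  ∑ i ∈ Finset.range (k.length + 1),
    ((-1) ^ (k.drop i).sum * starSh (k.take i)) • revHat (k.drop i)

theorem starHat_cons_snoc (a : ℕ) (B : List ℕ) (b : ℕ) :
    starHat (a :: (B ++ [b])) = (-1 : Sh) ^ (a + (B.sum + b)) • revHat (a :: (B ++ [b])) +
      ∑ n ∈ Finset.range (B.length + 1), ((-1) ^ ((B.drop n).sum + b) * starSh (a :: B.take n)) •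
        revHat (B.drop n ++ [b]) +
      C (starSh (a :: (B ++ [b]))) := by
  have h0 : starSh [] = 1 := rfl
  have h1 : revHat [] = 1 := by rw [revHat, hatOp_nil, h0, map_one]
  rw [starHat, Finset.sum_range_succ', List.length_cons, List.length_append, List.length_singleton,
    Finset.sum_range_succ, add_comm, ← add_assoc]
  congr 1
  · congr 1
    · simp [h0]
    · refine Finset.sum_congr rfl fun n hn => ?_
      have := Finset.mem_range.1 hn
      rw [List.drop_succ_cons, List.take_succ_cons, List.drop_append_of_le_length (by omega),
        List.take_append_of_le_length (by omega), List.sum_append, List.sum_singleton]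
  · rw [List.drop_of_length_le (by simp), List.take_of_length_le (by simp), h1,
      PowerSeries.smul_eq_C_mul]
    simp

/-- The cyclic rotations of `k`, starting with the entry number `i`. -/
theorem rotate_eq_cons (k : List ℕ) (i : Fin k.length) :
    k.rotate i = k.get i :: (k.drop (i + 1) ++ k.take i) := by
  rw [List.rotate_eq_drop_append_take i.2.le, List.drop_eq_getElem_cons i.2]
  rfl

theorem rotate_succ_eq_append (k : List ℕ) (i : Fin k.length) :
    k.rotate (i + 1) = (k.drop (i + 1) ++ k.take i) ++ [k.get i] := by
  rw [← List.rotate_rotate, rotate_eq_cons, List.rotate_cons_succ, List.rotate_zero]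

theorem sum_rotate_succ {M : Type*} [AddCommMonoid M] (k : List ℕ) (f : List ℕ → M) :
    ∑ i : Fin k.length, f (k.rotate (i + 1)) = ∑ i : Fin k.length, f (k.rotate i) := by
  rw [← Finset.sum_range fun i => f (k.rotate (i + 1)), ← Finset.sum_range fun i => f (k.rotate i)]
  cases hr : k.length with
  | zero => rfl
  | succ r =>
    rw [Finset.sum_range_succ, Finset.sum_range_succ' fun i => f (k.rotate i), ← hr,
      List.rotate_length, List.rotate_zero]

/-- The fork obtained by cutting a cyclic rotation of an index after `n` entries. -/
def cutFork (n : ℕ) (M : List ℕ) : PowerSeries Sh :=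
  (-1 : Sh) ^ (M.drop n).sum • forkHat (M.take n) (M.drop n)

/-- For each `n` the rotations by `i` and by `i + 1` run through the same cyclic family, so the sum
telescopes in `n`. -/
theorem sum_cutFork (k : List ℕ) :
    ∑ i : Fin k.length, ∑ n ∈ Finset.range k.length,
        (cutFork (n + 1) (k.rotate i) - cutFork n (k.rotate (i + 1))) =
      ∑ i : Fin k.length, (cutFork k.length (k.rotate i) - cutFork 0 (k.rotate i)) := by
  have h (n : ℕ) := sum_rotate_succ k (cutFork n)
  rw [Finset.sum_comm]
  simp only [Finset.sum_sub_distrib, h]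
  rw [← Finset.sum_sub_distrib,
    Finset.sum_range_sub fun n => ∑ i : Fin k.length, cutFork n (k.rotate i)]

/-- The terms of `w⋆_{CSF,Ŝ}` which belong to the cyclic rotation `(B, κ)`. -/
def csfPart (κ : ℕ) (B : List ℕ) : PowerSeries Sh :=
  ∑ j ∈ Finset.range (κ - 1), starHat ((j + 1) :: (B ++ [κ - j])) -
    seriesSum fun j => starHat ((j + 1) :: (B ++ [κ]))

/-- The terms of `w⋆_CSF` which belong to the cyclic rotation `(B, κ)`. -/
def csfTerm (κ : ℕ) (B : List ℕ) : Sh :=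
  ∑ j ∈ Finset.range (κ - 1), starSh ((j + 1) :: (B ++ [κ - j]))

theorem csfPart_eq (K : ℕ) (B : List ℕ) :
    csfPart (K + 1) B =
      C (csfTerm (K + 1) B) - (seriesSum fun j => C (headZig j (B ++ [K + 1]))) +
      ∑ n ∈ Finset.range (B.length + 1),
        (cutFork (n + 1) ((K + 1) :: B) - cutFork n (B ++ [K + 1])) +
      (-1 : Sh) ^ (B.sum + K + 2) •
        (hatOp B (fun M => seriesSum fun l => (K + 1 + l - 1).choose l • C (csfTerm (K + 1 + l) M)) -
          hatOp ((K + 1) :: B) fun M => seriesSum fun m => C (headZig m M)) := by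
  have hmid : ∀ n ∈ Finset.range (B.length + 1),
      cutFork (n + 1) ((K + 1) :: B) - cutFork n (B ++ [K + 1]) =
      (-1 : Sh) ^ (B.drop n).sum •
        (∑ j ∈ Finset.range K, ((-1) ^ (K + 1 - j) * headZig j (B.take n)) •
          revHat (B.drop n ++ [K + 1 - j]) -
        seriesSum (fun j => ((-1) ^ (K + 1) * headZig j (B.take n)) •
          revHat (B.drop n ++ [K + 1]))) := by
    intro n hn
    have := Finset.mem_range.1 hn
    rw [mid_identity, cutFork, cutFork, List.drop_succ_cons, List.take_succ_cons,
      List.drop_append_of_le_length (by omega), List.take_append_of_le_length (by omega),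
      List.sum_append, List.sum_singleton, smul_sub, pow_add, mul_smul]
  rw [Finset.sum_congr rfl hmid]
  unfold csfTerm
  rw [← revHat_identity]
  unfold csfPart
  simp only [starHat_cons_snoc, Nat.add_sub_cancel, Finset.sum_add_distrib]
  have hs (F G H' : ℕ → PowerSeries Sh) : seriesSum (fun j => F j + G j + H' j) =
      seriesSum F + seriesSum G + seriesSum H' := by
    rw [← map_add, ← map_add]; rfl
  have hs2 (s : Finset ℕ) (F : ℕ → ℕ → PowerSeries Sh) : seriesSum (fun j => ∑ n ∈ s, F n j) =
      ∑ n ∈ s, seriesSum (F n) := by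
    rw [← map_sum]; congr 1; funext j; simp
  rw [hs, hs2, Finset.sum_comm]
  have e1 : ∑ j ∈ Finset.range K, (-1 : Sh) ^ (j + 1 + (B.sum + (K + 1 - j))) •
      revHat ((j + 1) :: (B ++ [K + 1 - j])) =
      (-1 : Sh) ^ (B.sum + K + 2) • ∑ j ∈ Finset.range K, revHat ((j + 1) :: (B ++ [K + 1 - j])) := by
    rw [Finset.smul_sum]
    refine Finset.sum_congr rfl fun j hj => ?_
    have := Finset.mem_range.1 hj
    rw [show j + 1 + (B.sum + (K + 1 - j)) = B.sum + K + 2 by omega]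
  -- The last entry stays `K + 1` here, so the sign alternates with `j`, as `revHat_identity`
  -- requires; in `e1` the changes at the two ends compensate.
  have e2 : seriesSum (fun j => (-1 : Sh) ^ (j + 1 + (B.sum + (K + 1))) •
      revHat ((j + 1) :: (B ++ [K + 1]))) =
      (-1 : Sh) ^ (B.sum + K + 2) •
        seriesSum fun j => (-1 : Sh) ^ j • revHat ((j + 1) :: (B ++ [K + 1])) := by
    rw [← seriesSum_smul]
    congr 1
    funext j
    rw [smul_smul, ← pow_add]
    congr 2
    omega
  have e3 (n : ℕ) : ∑ j ∈ Finset.range K, ((-1) ^ ((B.drop n).sum + (K + 1 - j)) *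
      starSh ((j + 1) :: B.take n)) • revHat (B.drop n ++ [K + 1 - j]) =
      (-1 : Sh) ^ (B.drop n).sum • ∑ j ∈ Finset.range K, ((-1) ^ (K + 1 - j) *
        headZig j (B.take n)) • revHat (B.drop n ++ [K + 1 - j]) := by
    rw [Finset.smul_sum]
    refine Finset.sum_congr rfl fun j _ => ?_
    rw [smul_smul, ← mul_assoc, ← pow_add]
    rfl
  have e4 (n : ℕ) : seriesSum (fun j => ((-1) ^ ((B.drop n).sum + (K + 1)) *
      starSh ((j + 1) :: B.take n)) • revHat (B.drop n ++ [K + 1])) =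
      (-1 : Sh) ^ (B.drop n).sum • seriesSum fun j => ((-1) ^ (K + 1) *
        headZig j (B.take n)) • revHat (B.drop n ++ [K + 1]) := by
    rw [← seriesSum_smul]
    congr 1
    funext j
    rw [smul_smul, ← mul_assoc, ← pow_add]
    rfl
  have e5 : seriesSum (fun j => C (starSh ((j + 1) :: (B ++ [K + 1])))) =
    seriesSum fun j => C (headZig j (B ++ [K + 1])) := rfl
  simp only [e1, e2, e3, e4, e5, smul_sub, Finset.sum_sub_distrib, sum_C]
  abel

/-- Reversing an index reverses its cyclic order as well, so the rotations of the reversals are the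
reversals of the rotations; the order of summation is immaterial by `hatOp_comm`. -/
theorem hatOp_cyclic (k : List ℕ) (G : ℕ → List ℕ → PowerSeries Sh) :
    hatOp k (fun M => ∑ i : Fin M.length, G (M.get i) (M.drop (i + 1) ++ M.take i)) =
      ∑ i : Fin k.length, hatOp (k.drop (i + 1) ++ k.take i) fun M =>
        seriesSum fun l => (k.get i + l - 1).choose l • G (k.get i + l) M := by
  -- Entry `i` of `k` ends up at place `k.length - 1 - i` of the reversed index.
  have h : hatOp k (fun M => ∑ i : Fin M.length, G (M.get i) (M.drop (i + 1) ++ M.take i)) =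
      hatOp k fun M => ∑ i : Fin k.length, G (M.getD (k.length - 1 - i) 0)
        (M.drop (k.length - 1 - i + 1) ++ M.take (k.length - 1 - i)) := by
    refine hatOp_congr_length fun M hM => ?_
    rw [← Finset.sum_range fun i => G (M.getD (k.length - 1 - i) 0)
        (M.drop (k.length - 1 - i + 1) ++ M.take (k.length - 1 - i)),
      Finset.sum_range_reflect fun i => G (M.getD i 0) (M.drop (i + 1) ++ M.take i), ← hM,
      Finset.sum_range]
    refine Finset.sum_congr rfl fun i _ => ?_
    simp
  rw [h, hatOp_sum]
  refine Finset.sum_congr rfl fun i _ => ?_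
  have hki : k = k.take i ++ k.get i :: k.drop (i + 1) := by
    rw [List.get_eq_getElem, ← List.drop_eq_getElem_cons i.2, List.take_append_drop]
  have hop (Φ : List ℕ → PowerSeries Sh) :
      hatOp k Φ = hatOp (k.take i ++ k.get i :: k.drop (i + 1)) Φ :=
    congrArg (fun L => hatOp L Φ) hki
  rw [hop, hatOp_append, hatOp_append, hatOp_comm (k.drop (i + 1)) (k.take i)]
  congr 1
  funext M
  rw [hatOp_cons, hatOp_seriesSum]
  congr 1
  funext l
  rw [hatOp_nsmul]
  congr 1
  refine hatOp_congr_length fun N hN => ?_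
  rw [List.length_drop] at hN
  rw [show k.length - 1 - i = N.length by omega]
  simp

theorem mul_choose_add (a n : ℕ) : a * (a + n).choose n = (a + n) * (a + n - 1).choose n := by
  cases a with
  | zero => cases n <;> simp
  | succ a =>
    have h1 : (a + 1 + n).choose n = (a + n + 1).choose (a + 1) := by
      rw [← Nat.choose_symm_add, Nat.add_right_comm]
    have h2 : (a + 1 + n - 1).choose n = (a + n).choose a := by
      rw [show a + 1 + n - 1 = a + n by omega, Nat.choose_symm_add]
    rw [h1, h2, mul_comm, ← Nat.add_one_mul_choose_eq, Nat.add_right_comm]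

/-- This rests on a·C(a+n, n) = (a+n)·C(a+n-1, n), where a + n is the weight of the raised index. -/
theorem nsmul_revHat_singleton (k : List ℕ) :
    k.sum • revHat [k.sum + 1] = hatOp k fun M => C (M.sum • starSh [M.sum + 1]) := by
  rw [hatOp_comp_sum k fun n => C (n • starSh [n + 1])]
  simp only [revHat, hatOp_cons, hatOp_nil, List.nil_append, ← seriesSum_nsmul]
  congr 1
  funext n
  simp only [nsmul_C, ← mul_smul]
  congr 2
  · rw [mul_comm _ (k.sum + n), Nat.add_right_comm, Nat.add_sub_cancel, mul_choose_add]
  · congr 2; omega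

/-- The element `w⋆_CSF(k)` of the shuffle algebra. -/
def csfSh (k : List ℕ) : Sh :=
  ∑ i : Fin k.length, csfTerm (k.get i) (k.drop (i + 1) ++ k.take i) - k.sum • starSh [k.sum + 1]

/-- The `t`-adic series of `w⋆_{CSF,Ŝ}(k)` in the shuffle algebra. -/
def csfHat (k : List ℕ) : PowerSeries Sh :=
  ∑ i : Fin k.length, csfPart (k.get i) (k.drop (i + 1) ++ k.take i) -
    k.sum • starHat [k.sum + 1]

theorem starHat_singleton (n : ℕ) :
    starHat [n] = (-1 : Sh) ^ n • revHat [n] + C (starSh [n]) := by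
  have h0 : starSh [] = 1 := rfl
  have h1 : revHat [] = 1 := by rw [revHat, hatOp_nil, h0, map_one]
  have h2 : starSh [n] • (1 : PowerSeries Sh) = C (starSh [n]) := by
    rw [PowerSeries.smul_eq_C_mul, mul_one]
  simp [starHat, Finset.sum_range_succ, h0, h1, h2]

theorem cutFork_length (k M : List ℕ) (h : M.length = k.length) :
    cutFork k.length M = seriesSum fun m => C (headZig m M) := by
  rw [cutFork, ← h, List.drop_length, List.take_length, forkHat, hatOp_nil]
  simp [forkZig_nil_right]

theorem cutFork_zero (M : List ℕ) :
    cutFork 0 M = (-1 : Sh) ^ M.sum • hatOp M fun N => seriesSum fun m => C (headZig m N) := by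
  simp [cutFork, forkHat, forkZig_nil_left]

/-- Summed over all rotations, the two ends of the telescoping sum cancel the two `headZig` series
in `csfPart_eq`, forward and reversed. -/
theorem csfHat_eq {k : List ℕ} (hk : ∀ a ∈ k, 0 < a) :
    csfHat k = C (csfSh k) + (-1 : Sh) ^ (k.sum + 1) • hatOp k fun M => C (csfSh M) := by
  have hpart (i : Fin k.length) : csfPart (k.get i) (k.drop (i + 1) ++ k.take i) =
      C (csfTerm (k.get i) (k.drop (i + 1) ++ k.take i)) -
        (seriesSum fun j => C (headZig j (k.rotate (i + 1)))) +
      ∑ n ∈ Finset.range k.length,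
        (cutFork (n + 1) (k.rotate i) - cutFork n (k.rotate (i + 1))) +
      (-1 : Sh) ^ (k.sum + 1) •
        (hatOp (k.drop (i + 1) ++ k.take i) (fun M => seriesSum fun l =>
          (k.get i + l - 1).choose l • C (csfTerm (k.get i + l) M)) -
          hatOp (k.rotate i) fun M => seriesSum fun m => C (headZig m M)) := by
    obtain ⟨K, hK⟩ : ∃ K, k.get i = K + 1 :=
      ⟨k.get i - 1, (Nat.sub_add_cancel (hk _ (List.get_mem _ _))).symm⟩
    have hl : k.length = (k.drop (i + 1) ++ k.take i).length + 1 := by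
      simp; omega
    have hs : (k.rotate i).sum = k.sum := (List.rotate_perm k i).sum_eq
    rw [rotate_eq_cons, List.sum_cons, hK] at hs
    rw [rotate_eq_cons, rotate_succ_eq_append, hK, csfPart_eq, ← hl,
      show (k.drop (i + 1) ++ k.take i).sum + K + 2 = k.sum + 1 by omega]
  have hterm := hatOp_cyclic k fun κ B => C (csfTerm κ B)
  have hsum := nsmul_revHat_singleton k
  have hcut := sum_cutFork k
  have hfwd := sum_rotate_succ k fun M => seriesSum fun j => C (headZig j M)
  have hlen (i : Fin k.length) := cutFork_length k (k.rotate i) (List.length_rotate k i)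
  have hzero (i : Fin k.length) : cutFork 0 (k.rotate i) = (-1 : Sh) ^ k.sum •
      hatOp (k.rotate i) fun N => seriesSum fun m => C (headZig m N) := by
    rw [cutFork_zero, (List.rotate_perm k i).sum_eq]
  simp only [hlen, hzero] at hcut
  unfold csfHat csfSh
  simp only [hpart, Finset.sum_add_distrib, Finset.sum_sub_distrib (f := fun i => C _),
    starHat_singleton, map_sub, hatOp_sub, map_sum] at hcut hterm ⊢
  rw [hcut, hterm, hfwd, ← hsum, ← nsmul_C]
  simp only [smul_sub, Finset.sum_sub_distrib, ← Finset.smul_sum, pow_succ]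
  generalize k.sum = S
  module

/-! ### Transfer to `ℌ[[t]]` -/

theorem toSh_W_mul (p q : P) : toSh (W (p * q)) = toSh (W p) * toSh (W q) := by
  have hcls (X : TwoPosetClass) (Y : TwoPosetClass) : W (MonoidAlgebra.single (X * Y) 1) =
      sh (W (MonoidAlgebra.single X 1)) (W (MonoidAlgebra.single Y 1)) := by
    obtain ⟨X⟩ := X
    obtain ⟨Y⟩ := Y
    exact (W_cls (X.disj Y)).trans ((X.W_disj Y).trans (by rw [← W_cls, ← W_cls]; rfl))
  rw [← toSh_sh]
  congr 1
  induction p using MonoidAlgebra.induction_linear with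
  | zero => simp
  | add p p' h h' => simp only [add_mul, map_add, LinearMap.add_apply, h, h']
  | single X a =>
    induction q using MonoidAlgebra.induction_linear with
    | zero => simp
    | add p p' h h' => simp only [mul_add, map_add, h, h']
    | single Y b =>
      have e (X : TwoPosetClass) (a : ℚ) : (MonoidAlgebra.single X a : P) =
          a • MonoidAlgebra.single X 1 := by simp
      rw [MonoidAlgebra.single_mul_single, e, e X, e Y]
      simp only [map_smul, LinearMap.smul_apply, hcls, mul_smul]
      exact smul_comm _ _ _

/-- The map `W` as a ring homomorphism into the shuffle algebra. -/
def shW : P →+* Sh where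
  toFun p := toSh (W p)
  map_one' := by
    rw [← toSh_one]
    congr 1
    exact (W_cls TwoPoset.empty).trans (by
      rw [TwoPoset.W_eq_orderSum, orderSum_eq_linExtSum]
      exact linExtSum_empty _ _)
  map_mul' := toSh_W_mul
  map_zero' := by simp
  map_add' p q := by simp

theorem shW_cls_XStar {k : List ℕ} (hk : ∀ a ∈ k, 0 < a) : shW (cls (XStar k)) = starSh k :=
  congrArg toSh (wStar_eq_zigWord hk)

theorem map_revSeries (Φ : List ℕ → P) (k : List ℕ) :
    PowerSeries.map shW (revSeries Φ k) = revSeries (fun M => shW (Φ M)) k := by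
  ext n
  simp [revSeries]

theorem map_XStarHat {k : List ℕ} (hk : ∀ a ∈ k, 0 < a) :
    PowerSeries.map shW (XStarHat k) = starHat k := by
  rw [XStarHat, starHat, map_sum]
  refine Finset.sum_congr rfl fun i _ => ?_
  rw [map_mul, map_mul, map_pow, map_neg, map_one, PowerSeries.map_C, map_revSeries,
    revSeries_eq_hatOp, shW_cls_XStar fun a ha => hk a (List.mem_of_mem_take ha), mul_smul,
    PowerSeries.smul_eq_C_mul, PowerSeries.smul_eq_C_mul, map_pow, map_neg, map_one]
  congr 2
  exact hatOp_congr (fun a ha => hk a (List.mem_of_mem_drop ha)) fun M hM _ => by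
    rw [shW_cls_XStar hM]

theorem toSh_coeff_wStarHat {k : List ℕ} (hk : ∀ a ∈ k, 0 < a) (n : ℕ) :
    toSh (coeff n (wStarHat k)) = coeff n (starHat k) := by
  rw [← map_XStarHat hk, PowerSeries.coeff_map, wStarHat, Wt, PowerSeries.coeff_mk]
  rfl

theorem cyc_pos {k : List ℕ} (hk : ∀ a ∈ k, 0 < a) {i a b : ℕ} (ha : 0 < a) (hb : 0 < b) :
    ∀ c ∈ cyc k i a b, 0 < c := by
  intro c hc
  simp only [cyc, List.mem_cons, List.mem_append, List.not_mem_nil, or_false] at hc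
  rcases hc with rfl | (hc | hc) | rfl
  · exact ha
  · exact hk c (List.mem_of_mem_drop hc)
  · exact hk c (List.mem_of_mem_take hc)
  · exact hb

theorem toSh_wCSF {k : List ℕ} (hk : ∀ a ∈ k, 0 < a) : toSh (wCSF k) = csfSh k := by
  rw [wCSF, csfSh, map_sub, map_sum, Nat.cast_smul_eq_nsmul, map_nsmul,
    wStar_eq_zigWord (by simp)]
  congr 1
  refine Finset.sum_congr rfl fun i _ => ?_
  rw [map_sum]
  refine Finset.sum_congr rfl fun j hj => ?_
  rw [wStar_eq_zigWord (cyc_pos hk (by omega) (by have := Finset.mem_range.1 hj; omega))]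
  rfl

theorem toSh_coeff_wCSFHat {k : List ℕ} (hk : ∀ a ∈ k, 0 < a) (n : ℕ) :
    toSh (coeff n (wCSFHat k)) = coeff n (csfHat k) := by
  have h1 : coeff n ((k.sum : ℚ) • wStarHat [k.sum + 1]) =
      k.sum • coeff n (wStarHat [k.sum + 1]) := by
    rw [Nat.cast_smul_eq_nsmul, map_nsmul]
  rw [wCSFHat, csfHat, map_sub, map_sub, map_sub, map_sub, map_sub, h1, map_nsmul, map_nsmul,
    toSh_coeff_wStarHat (by simp)]
  congr 1
  simp only [csfPart, map_sum, map_sub, Finset.sum_sub_distrib]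
  congr 1
  · refine Finset.sum_congr rfl fun i _ => Finset.sum_congr rfl fun j hj => ?_
    rw [toSh_coeff_wStarHat (cyc_pos hk (by omega) (by have := Finset.mem_range.1 hj; omega))]
    rfl
  · refine Finset.sum_congr rfl fun i _ => ?_
    rw [shiftSum, PowerSeries.coeff_mk, coeff_seriesSum,
      Finset.Nat.sum_antidiagonal_eq_sum_range_succ_mk, map_sum]
    refine Finset.sum_congr rfl fun j _ => ?_
    rw [toSh_coeff_wStarHat (cyc_pos hk (by omega) (hk _ (List.get_mem _ _)))]
    rfl

theorem wCSF_mem_H1 (k : List ℕ) : wCSF k ∈ H1 :=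
  sub_mem (sum_mem fun _ _ => sum_mem fun _ _ => wStar_mem_H1 _)
    (H1.smul_mem (wStar_mem_H1 _) _)

theorem coeff_neg_one_pow_mul {R : Type*} [Ring R] (m n : ℕ) (F : PowerSeries R) :
    coeff n ((-1) ^ m * F) = (-1) ^ m * coeff n F := by
  rcases neg_one_pow_eq_or (PowerSeries R) m with h | h <;>
    rcases m.even_or_odd with hm | hm <;> simp [hm.neg_one_pow]

theorem wCSFHat_eq {k : List ℕ} (hk : ∀ a ∈ k, 0 < a) :
    wCSFHat k = C (wCSF k) + (-1) ^ (k.sum + 1) * revSeries wCSF k := by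
  -- `toSh` is only linear, but the statement multiplies in ℌ[[t]] by signs alone, so comparing
  -- coefficients suffices.
  ext n
  apply toSh.injective
  have hrev : revSeries csfSh k = hatOp k fun M => C (csfSh M) := revSeries_eq_hatOp _ _
  have hcoe : toSh (coeff n (revSeries wCSF k)) = coeff n (revSeries csfSh k) := by
    rw [revSeries, revSeries, PowerSeries.coeff_mk, PowerSeries.coeff_mk, map_sum]
    refine Finset.sum_congr rfl fun l _ => ?_
    rw [map_nsmul, toSh_wCSF]
    intro a ha
    obtain ⟨j, rfl⟩ := List.mem_ofFn.1 (List.mem_reverse.1 ha)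
    have := hk _ (List.get_mem k j)
    omega
  have hC : toSh (coeff n (C (wCSF k))) = coeff n (C (csfSh k)) := by
    rw [PowerSeries.coeff_C, PowerSeries.coeff_C, ← toSh_wCSF hk]
    split_ifs <;> simp
  rw [toSh_coeff_wCSFHat hk, csfHat_eq hk, map_add, map_add, map_add, hC, ← hrev,
    coeff_neg_one_pow_mul]
  congr 1
  rcases (k.sum + 1).even_or_odd with h | h <;> simp [h.neg_one_pow, hcoe]

theorem coeff_wCSFHat_mem_H1 {k : List ℕ} (hk : ∀ a ∈ k, 0 < a) (n : ℕ) :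
    coeff n (wCSFHat k) ∈ H1 := by
  rw [wCSFHat_eq hk, map_add, coeff_neg_one_pow_mul, PowerSeries.coeff_C, revSeries,
    PowerSeries.coeff_mk]
  refine add_mem ?_ (mul_mem (pow_mem (neg_mem (one_mem _)) _)
    (sum_mem fun l _ => nsmul_mem (wCSF_mem_H1 _) _))
  split_ifs
  · exact wCSF_mem_H1 k
  · exact zero_mem _

end KYStar

end

open KYStar in
theorem theorem2p5 (k : List ℕ) (hk : ∀ a ∈ k, 0 < a) :
    (wCSF k ∈ H1 ∧ ∀ n, PowerSeries.coeff n (wCSFHat k) ∈ H1) ∧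
    wCSFHat k = PowerSeries.C (wCSF k) + (-1) ^ (k.sum + 1) * revSeries wCSF k :=
  ⟨⟨wCSF_mem_H1 k, coeff_wCSFHat_mem_H1 hk⟩, wCSFHat_eq hk⟩
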